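/- A monic real polynomial $P$ of degree $n$ is *realizable* if it is the characteristic polynomial of an entrywise nonnegative $n\times n$ matrix, i.e. of (the adjacency matrix of) a weighted digraph on $n$ vertices with positive arc weights; it is *irreducibly realizable* if the matrix can be chosen irreducible, i.e. the digraph strongly connected. A weighted digraph on the vertices $1,\dots,n$ is a *simple EBL digraph* if each arc $(i,i+1)$, $1\le i\le n-1$, is present with weight $1$, every other arc ends at vertex $1$ or starts at vertex $n$, and every cycle is, for some $1\le r\le n$, of the form $1,2,\dots,r,1$ or $n-r+1,\dots,n,n-r+1$. **Theorem.** Let $p\ge 3$, let $k_p,\dots,k_{2p+1}$ be real numbers, and let $$P(x)=x^{2p+1}+k_px^{p+1}+k_{p+1}x^{p}+\dots+k_{2p}x+k_{2p+1}\neq x^{2p+1}.$$ Consider the three configurations 1. $k_p<0$, $k_{p+1}<0$, $k_{p+2}=\dots=k_{2p}=0$ and $k_{2p+1}=k_pk_{p+1}$; 2. $k_p<0$, $k_{p+1}<0$, $k_{p+2}=\dots=k_{2p-1}=0$, $0<k_{2p}<\frac{k_p^2}{4}$ and $k_{2p+1}=k_{p+1}\left(\frac{k_p}{2}-\sqrt{\frac{k_p^2}{4}-k_{2p}}\right)$;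 3. $k_p<0$, $k_{p+1}=\dots=k_{2p-1}=k_{2p+1}=0$ and $k_{2p}=\frac{k_p^2}{4}$. If none of 1–3 holds, then $P$ is realizable if and only if it is irreducibly realizable. If one of 1–3 holds, then $P$ is realizable but not irreducibly realizable. Moreover, whenever $P$ is irreducibly realizable, it is the characteristic polynomial of a strongly connected simple EBL digraph. -/

import Mathlib

/-- A monic real polynomial `P` (of degree `n`) is realizable if it is the characteristic
polynomial of an entrywise nonnegative `n × n` matrix. Such matrices are exactly the adjacency
matrices of weighted digraphs on `n` vertices, with an arc `i → j` whenever `0 < A i j`. -/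
def Realizable (n : ℕ) (P : Polynomial ℝ) : Prop :=
  ∃ A : Matrix (Fin n) (Fin n) ℝ, (∀ i j, 0 ≤ A i j) ∧ A.charpoly = P

/-- `P` is irreducibly realizable if it is the characteristic polynomial of an irreducible
nonnegative `n × n` matrix, i.e. of a strongly connected weighted digraph
(`Matrix.IsIrreducible` includes entrywise nonnegativity). -/
def IrreduciblyRealizable (n : ℕ) (P : Polynomial ℝ) : Prop :=
  ∃ A : Matrix (Fin n) (Fin n) ℝ, A.IsIrreducible ∧ A.charpoly = P

/-- `c 0, c 1, …, c m, c 0` is a cycle (of length `m + 1`; a loop if `m = 0`) of the weighted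
digraph with adjacency matrix `A`: the vertices are distinct and consecutive ones, cyclically,
are joined by arcs. Addition in `Fin (m + 1)` is cyclic. -/
def IsDigraphCycle {n : ℕ} (A : Matrix (Fin n) (Fin n) ℝ) {m : ℕ} (c : Fin (m + 1) → Fin n) :
    Prop :=
  Function.Injective c ∧ ∀ s, 0 < A (c s) (c (s + 1))

/-- The weighted digraph on the vertices `0, 1, …, n - 1` with adjacency matrix `A` is a simple
EBL digraph. -/
structure IsSimpleEBL {n : ℕ} (A : Matrix (Fin n) (Fin n) ℝ) : Prop where
  nonneg : ∀ i j, 0 ≤ A i j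
  /-- The basic path `0 → 1 → ⋯ → n - 1` has all weights equal to one. -/
  path : ∀ i j : Fin n, (j : ℕ) = i + 1 → A i j = 1
  /-- Every other arc ends in the first vertex or starts in the last one. -/
  arcs : ∀ i j : Fin n, 0 < A i j → (j : ℕ) = i + 1 ∨ (j : ℕ) = 0 ∨ (i : ℕ) + 1 = n
  /-- Up to the choice of the starting vertex, every cycle of length `r = m + 1` is
  `0, 1, …, r - 1, 0` or `n - r, …, n - 1, n - r`. -/
  cycles : ∀ (m : ℕ) (c : Fin (m + 1) → Fin n), IsDigraphCycle A c →
    (∃ t, ∀ s, (c (t + s) : ℕ) = s) ∨ (∃ t, ∀ s, (c (t + s) : ℕ) + (m + 1) = n + s)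

/-- `x^(2p+1) + k_p x^(p+1) + k_(p+1) x^p + ⋯ + k_(2p) x + k_(2p+1)`; only the values
`k p, …, k (2 * p + 1)` matter. -/
noncomputable def oddGapPoly (p : ℕ) (k : ℕ → ℝ) : Polynomial ℝ :=
  Polynomial.X ^ (2 * p + 1) +
    ∑ j ∈ Finset.Icc p (2 * p + 1), Polynomial.C (k j) * Polynomial.X ^ (2 * p + 1 - j)

/-- The three exceptional coefficient configurations. -/
def ExceptionalCoeffs (p : ℕ) (k : ℕ → ℝ) : Prop :=
  (k p < 0 ∧ k (p + 1) < 0 ∧ (∀ j, p + 2 ≤ j → j ≤ 2 * p → k j = 0) ∧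
    k (2 * p + 1) = k p * k (p + 1)) ∨
  (k p < 0 ∧ k (p + 1) < 0 ∧ (∀ j, p + 2 ≤ j → j ≤ 2 * p - 1 → k j = 0) ∧
    0 < k (2 * p) ∧ k (2 * p) < k p ^ 2 / 4 ∧
    k (2 * p + 1) = k (p + 1) * (k p / 2 - √(k p ^ 2 / 4 - k (2 * p)))) ∨
  (k p < 0 ∧ (∀ j, p + 1 ≤ j → j ≤ 2 * p - 1 → k j = 0) ∧
    k (2 * p) = k p ^ 2 / 4 ∧ k (2 * p + 1) = 0)

/-!
The coefficient of `x^(n-j)` in the characteristic polynomial is the sum, over the sets of disjoint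
cycles covering `j` vertices in all, of the products of the arc weights, with one sign per cycle. If
`n = 2p + 1` and the coefficients `k_1, …, k_(p-1)` vanish, then all cycles have length at least
`p`, so no three of them are disjoint and the graph of disjoint pairs of cycles is triangle-free.
Let `a = -k_p` and `b = -k_(p+1)` be the total weights of the `p`-cycles and of the `(p+1)`-cycles,
and let `α` be the largest weight of a family of pairwise intersecting `p`-cycles. As the cycles
disjoint from a given one form such a family, `k_(2p) ≤ α (a - α)` and `k_(2p+1) ≤ α b`. In the
exceptional configurations these inequalities are equalities, which forces some family of
`p`-cycles to be disjoint from all remaining cycles; no strongly connected digraph allows this.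
Conversely, an EBL digraph whose cycles at the two ends share the weights `a` and `b` equally, if
`2 k_(2p+1) ≤ a b`, or as `α, a - α` and `0, b` otherwise, realizes the polynomial. It can fail to
be strongly connected only if both inequalities are equalities.
-/

open Finset Polynomial

section TriangleFreeGraphs

variable {V R : Type*}

section EdgeWeight

variable [CommSemiring R] (G : SimpleGraph V) [DecidableRel G.Adj] (x : V → R)

/-- The total weight of the edges between two sets of vertices of a vertex-weighted graph, the
weight of an edge being the product of the weights of its ends. It runs over ordered pairs, so
that an edge inside `s ∩ t` is counted twice. -/
def edgeWeight (s t : Finset V) : R :=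
  ∑ c ∈ s, x c * ∑ d ∈ t with G.Adj c d, x d

theorem edgeWeight_eq_sum_product (s t : Finset V) :
    edgeWeight G x s t = ∑ q ∈ s ×ˢ t with G.Adj q.1 q.2, x q.1 * x q.2 := by
  simp only [edgeWeight, mul_sum, sum_filter, sum_product, mul_ite, mul_zero]

theorem edgeWeight_comm (s t : Finset V) : edgeWeight G x s t = edgeWeight G x t s := by
  simp only [edgeWeight, mul_sum, sum_filter, mul_ite, mul_zero]
  rw [sum_comm]
  simp only [G.adj_comm, mul_comm]

theorem edgeWeight_eq_zero_of_isIndepSet {I : Finset V} (hI : G.IsIndepSet (I : Set V)) :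
    edgeWeight G x I I = 0 := by
  refine sum_eq_zero fun c hc => ?_
  rw [filter_false_of_mem fun d hd hcd => hI hc hd hcd.ne hcd, sum_empty, mul_zero]

end EdgeWeight

variable [CommRing R] [LinearOrder R] {G : SimpleGraph V} {x : V → R} {F H I s t : Finset V}

/-- `I` is an independent set of the vertex-weighted graph induced on `F`, and no other one is
heavier. -/
structure IsMaxWeightIndepSet (G : SimpleGraph V) (x : V → R) (F I : Finset V) : Prop where
  subset : I ⊆ F
  isIndepSet : G.IsIndepSet (I : Set V)
  sum_le : ∀ J ⊆ F, G.IsIndepSet (J : Set V) → ∑ c ∈ J, x c ≤ ∑ c ∈ I, x c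

theorem exists_isMaxWeightIndepSet (G : SimpleGraph V) (x : V → R) (F : Finset V) :
    ∃ I, IsMaxWeightIndepSet G x F I := by
  classical
  obtain ⟨I, hI, hmax⟩ := exists_max_image
    (F.powerset.filter fun J : Finset V => G.IsIndepSet (J : Set V)) (fun J => ∑ c ∈ J, x c)
    ⟨∅, by simp [SimpleGraph.IsIndepSet]⟩
  simp only [mem_filter, mem_powerset] at hI hmax
  exact ⟨I, hI.1, hI.2, fun J hJ hJ' => hmax J ⟨hJ, hJ'⟩⟩

variable [DecidableRel G.Adj]

theorem isIndepSet_filter_adj (hG : G.CliqueFree 3) (F : Finset V) (c : V) :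
    G.IsIndepSet (({d ∈ F | G.Adj c d} : Finset V) : Set V) :=
  (G.isIndepSet_neighborSet_of_triangleFree hG c).mono fun d hd => by simp_all

theorem IsMaxWeightIndepSet.sum_adj_le (hI : IsMaxWeightIndepSet G x F I) (hG : G.CliqueFree 3)
    (c : V) : ∑ d ∈ F with G.Adj c d, x d ≤ ∑ d ∈ I, x d :=
  hI.sum_le _ (filter_subset _ _) (isIndepSet_filter_adj hG F c)

theorem IsMaxWeightIndepSet.filter_adj (hI : IsMaxWeightIndepSet G x F I) (hG : G.CliqueFree 3)
    {c : V} (hc : ∑ d ∈ F with G.Adj c d, x d = ∑ d ∈ I, x d) :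
    IsMaxWeightIndepSet G x F {d ∈ F | G.Adj c d} :=
  ⟨filter_subset _ _, isIndepSet_filter_adj hG F c, fun J hJ hJ' => hc ▸ hI.sum_le J hJ hJ'⟩

theorem IsMaxWeightIndepSet.edgeWeight_self [DecidableEq V] (hI : IsMaxWeightIndepSet G x F I) :
    edgeWeight G x F F = edgeWeight G x (F \ I) I + edgeWeight G x (F \ I) F := by
  have hsplit : ∀ t, edgeWeight G x F t = edgeWeight G x (F \ I) t + edgeWeight G x I t :=
    fun t => (sum_sdiff hI.subset).symm
  rw [hsplit, edgeWeight_comm G x I, hsplit I, edgeWeight_eq_zero_of_isIndepSet G x hI.isIndepSet,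
    add_zero, add_comm]

variable [IsStrictOrderedRing R]

theorem edgeWeight_le_mul (hx : ∀ c ∈ s, 0 ≤ x c) {m : R}
    (hm : ∀ c ∈ s, ∑ d ∈ t with G.Adj c d, x d ≤ m) :
    edgeWeight G x s t ≤ (∑ c ∈ s, x c) * m := by
  rw [edgeWeight, sum_mul]
  exact sum_le_sum fun c hc => mul_le_mul_of_nonneg_left (hm c hc) (hx c hc)

theorem sum_adj_eq_of_mul_le_edgeWeight (hx : ∀ c ∈ s, 0 < x c) {m : R}
    (hm : ∀ c ∈ s, ∑ d ∈ t with G.Adj c d, x d ≤ m)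
    (h : (∑ c ∈ s, x c) * m ≤ edgeWeight G x s t) {c : V} (hc : c ∈ s) :
    ∑ d ∈ t with G.Adj c d, x d = m := by
  rw [edgeWeight, sum_mul] at h
  have hle : ∀ c ∈ s, x c * ∑ d ∈ t with G.Adj c d, x d ≤ x c * m := fun c hc =>
    mul_le_mul_of_nonneg_left (hm c hc) (hx c hc).le
  have heq := (sum_eq_sum_iff_of_le hle).mp ((sum_le_sum hle).antisymm h) c hc
  exact mul_left_cancel₀ (hx c hc).ne' heq

theorem sum_adj_le_sum (hx : ∀ d ∈ t, 0 ≤ x d) (c : V) :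
    ∑ d ∈ t with G.Adj c d, x d ≤ ∑ d ∈ t, x d :=
  sum_le_sum_of_subset_of_nonneg (filter_subset _ _) fun d hd _ => hx d hd

theorem adj_of_mul_le_edgeWeight (hs : ∀ c ∈ s, 0 < x c) (ht : ∀ d ∈ t, 0 < x d)
    (h : (∑ c ∈ s, x c) * ∑ d ∈ t, x d ≤ edgeWeight G x s t) :
    ∀ c ∈ s, ∀ d ∈ t, G.Adj c d := by
  intro c hc d hd
  have hsum := sum_adj_eq_of_mul_le_edgeWeight hs
    (fun c _ => sum_adj_le_sum (fun d hd => (ht d hd).le) c) h hc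
  by_contra hcd
  refine hsum.not_lt (sum_lt_sum_of_subset (filter_subset _ _) hd ?_ (ht d hd) fun e he _ =>
    (ht e he).le)
  simp [hcd]

theorem IsMaxWeightIndepSet.edgeWeight_self_le (hI : IsMaxWeightIndepSet G x F I)
    (hG : G.CliqueFree 3) (hx : ∀ c ∈ F, 0 ≤ x c) :
    edgeWeight G x F F ≤ 2 * ((∑ c ∈ I, x c) * (∑ c ∈ F, x c - ∑ c ∈ I, x c)) := by
  classical
  have hx' : ∀ c ∈ F \ I, 0 ≤ x c := fun c hc => hx c (sdiff_subset hc)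
  have hIx : ∀ c ∈ I, 0 ≤ x c := fun c hc => hx c (hI.subset hc)
  have hleft := edgeWeight_le_mul hx' fun c _ => sum_adj_le_sum (G := G) hIx c
  have hright := edgeWeight_le_mul hx' fun c _ => hI.sum_adj_le hG c
  rw [hI.edgeWeight_self, ← sum_sdiff_eq_sub hI.subset]
  linarith

theorem IsMaxWeightIndepSet.adj_of_le_edgeWeight [DecidableEq V]
    (hI : IsMaxWeightIndepSet G x F I) (hG : G.CliqueFree 3) (hx : ∀ c ∈ F, 0 < x c)
    (h : 2 * ((∑ c ∈ I, x c) * (∑ c ∈ F, x c - ∑ c ∈ I, x c)) ≤ edgeWeight G x F F) :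
    ∀ c ∈ F \ I, ∀ d ∈ I, G.Adj c d := by
  have hx' : ∀ c ∈ F \ I, 0 < x c := fun c hc => hx c (sdiff_subset hc)
  have hright := edgeWeight_le_mul (fun c hc => (hx' c hc).le) fun c _ => hI.sum_adj_le hG c
  rw [hI.edgeWeight_self, ← sum_sdiff_eq_sub hI.subset] at h
  exact adj_of_mul_le_edgeWeight hx' (fun c hc => hx c (hI.subset hc)) (by linarith)

-- Both neighbourhoods weigh more than half of `F`, so they share a vertex `e`. A vertex of one of
-- them outside the other would be joined to `e` by maximality of the latter.
theorem IsMaxWeightIndepSet.adj_of_sum_adj_eq (hI : IsMaxWeightIndepSet G x F I)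
    (hG : G.CliqueFree 3) (hx : ∀ c ∈ F, 0 < x c)
    (hF : 2 * ((∑ c ∈ I, x c) * (∑ c ∈ F, x c - ∑ c ∈ I, x c)) ≤ edgeWeight G x F F)
    (hlarge : ∑ c ∈ F, x c < 2 * ∑ c ∈ I, x c) {y z : V}
    (hy : ∑ d ∈ F with G.Adj y d, x d = ∑ d ∈ I, x d)
    (hz : ∑ d ∈ F with G.Adj z d, x d = ∑ d ∈ I, x d) {d : V} (hd : d ∈ F) (hyd : G.Adj y d) :
    G.Adj z d := by
  classical
  obtain ⟨e, hey, hez⟩ : ∃ e ∈ ({d ∈ F | G.Adj y d} : Finset V), e ∈ {d ∈ F | G.Adj z d} := by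
    rw [← not_disjoint_iff]
    intro hdisj
    have hle := sum_le_sum_of_subset_of_nonneg
      (union_subset (filter_subset (G.Adj y) F) (filter_subset (G.Adj z) F))
      fun c hc _ => (hx c hc).le
    rw [sum_union hdisj, hy, hz] at hle
    linarith
  by_contra hzd
  have hde : G.Adj d e := (hI.filter_adj hG hz).adj_of_le_edgeWeight hG hx (by rwa [hz]) d
    (by simp [hd, hzd]) e hez
  exact isIndepSet_filter_adj hG F y (by simp [hd, hyd]) hey hde.ne hde

theorem IsMaxWeightIndepSet.exists_subset_forall_adj [DecidableEq V]
    (hI : IsMaxWeightIndepSet G x F I) (hG : G.CliqueFree 3) (hxF : ∀ c ∈ F, 0 < x c)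
    (hxH : ∀ c ∈ H, 0 < x c)
    (hF : 2 * ((∑ c ∈ I, x c) * (∑ c ∈ F, x c - ∑ c ∈ I, x c)) ≤ edgeWeight G x F F)
    (hH : (∑ c ∈ H, x c) * ∑ c ∈ I, x c ≤ edgeWeight G x H F)
    (hlarge : H.Nonempty → ∑ c ∈ F, x c < 2 * ∑ c ∈ I, x c) :
    ∃ S ⊆ F, ∑ c ∈ S, x c = ∑ c ∈ I, x c ∧
      (∀ c ∈ F \ S, ∀ d ∈ S, G.Adj c d) ∧ ∀ c ∈ H, ∀ d ∈ S, G.Adj c d := by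
  have hnbr : ∀ c ∈ H, ∑ d ∈ F with G.Adj c d, x d = ∑ d ∈ I, x d := fun c =>
    sum_adj_eq_of_mul_le_edgeWeight hxH (fun c _ => hI.sum_adj_le hG c) hH
  obtain rfl | ⟨y, hy⟩ := H.eq_empty_or_nonempty
  · exact ⟨I, hI.subset, rfl, hI.adj_of_le_edgeWeight hG hxF hF, by simp⟩
  · refine ⟨{d ∈ F | G.Adj y d}, filter_subset _ _, hnbr y hy,
      (hI.filter_adj hG (hnbr y hy)).adj_of_le_edgeWeight hG hxF (by rwa [hnbr y hy]),
      fun z hz d hd => ?_⟩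
    rw [mem_filter] at hd
    exact hI.adj_of_sum_adj_eq hG hxF hF (hlarge ⟨y, hy⟩) (hnbr y hy) (hnbr z hz) hd.1 hd.2

end TriangleFreeGraphs

section CycleWeights

variable {ι R : Type*} [Fintype ι] [DecidableEq ι]

section CommRing

variable [CommRing R]

/-- The product of the arc weights of the linear subdigraph formed by the nontrivial cycles
of `σ`, in the weighted digraph with adjacency matrix `A`. -/
def permWeight (A : Matrix ι ι R) (σ : Equiv.Perm ι) : R :=
  ∏ i ∈ σ.support, A i (σ i)

theorem permWeight_mul (A : Matrix ι ι R) {σ τ : Equiv.Perm ι} (h : σ.Disjoint τ) :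
    permWeight A (σ * τ) = permWeight A σ * permWeight A τ := by
  unfold permWeight
  rw [h.support_mul, prod_union (Equiv.Perm.disjoint_iff_disjoint_support.mp h)]
  congr 1
  · refine prod_congr rfl fun i hi => ?_
    rw [Equiv.Perm.mul_apply, (h i).resolve_left (Equiv.Perm.mem_support.mp hi)]
  · refine prod_congr rfl fun i hi => ?_
    rw [h.commute.eq, Equiv.Perm.mul_apply, (h i).resolve_right (Equiv.Perm.mem_support.mp hi)]

theorem prod_charmatrix_perm {A : Matrix ι ι R} (hdiag : ∀ i, A i i = 0) (σ : Equiv.Perm ι) :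
    ∏ i, A.charmatrix (σ i) i =
      C ((-1) ^ #σ.support * permWeight A.transpose σ) * X ^ (Fintype.card ι - #σ.support) := by
  rw [← prod_sdiff (subset_univ σ.support), mul_comm]
  congr 1
  · rw [permWeight, map_mul, map_prod, map_pow, map_neg, map_one, ← prod_const,
      ← prod_mul_distrib]
    refine prod_congr rfl fun i hi => ?_
    rw [Matrix.charmatrix_apply_ne _ _ _ (Equiv.Perm.mem_support.mp hi), Matrix.transpose_apply]
    ring
  · rw [← card_univ, ← card_sdiff_of_subset (subset_univ _), ← prod_const]
    refine prod_congr rfl fun i hi => ?_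
    have hfix : σ i = i := by simpa using hi
    rw [hfix, Matrix.charmatrix_apply_eq, hdiag, map_zero, sub_zero]

theorem sign_mul_neg_one_pow_card_support (σ : Equiv.Perm ι) :
    ((Equiv.Perm.sign σ : ℤ) : R) * (-1) ^ #σ.support = (-1) ^ Multiset.card σ.cycleType := by
  rw [Equiv.Perm.sign_of_cycleType, Equiv.Perm.sum_cycleType]
  push_cast
  rw [add_comm, pow_add, mul_assoc, ← mul_pow, neg_one_mul, neg_neg, one_pow, mul_one]

theorem charpoly_coeff_eq_sum_permWeight {A : Matrix ι ι R} (hdiag : ∀ i, A i i = 0) {j : ℕ}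
    (hj : j ≤ Fintype.card ι) :
    A.charpoly.coeff (Fintype.card ι - j) =
      ∑ σ : Equiv.Perm ι with #σ.support = j,
        (-1) ^ Multiset.card σ.cycleType * permWeight A σ := by
  rw [← Matrix.charpoly_transpose, Matrix.charpoly, Matrix.det_apply', finsetSum_coeff,
    sum_filter]
  refine sum_congr rfl fun σ _ => ?_
  have hσ : #σ.support ≤ Fintype.card ι := card_le_univ _
  rw [prod_charmatrix_perm (A := A.transpose) hdiag, Matrix.transpose_transpose, ← C_eq_intCast,
    ← mul_assoc, ← map_mul, coeff_C_mul, coeff_X_pow, ← mul_assoc,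
    sign_mul_neg_one_pow_card_support, mul_ite, mul_one, mul_zero]
  exact if_congr (by omega) rfl rfl

end CommRing

variable [CommRing R] [LinearOrder R]

/-- The cyclic permutation `c` is a cycle of length at least two of the weighted digraph with
adjacency matrix `A`. -/
structure IsPosCycle (A : Matrix ι ι R) (c : Equiv.Perm ι) : Prop where
  isCycle : c.IsCycle
  permWeight_pos : 0 < permWeight A c

/-- The cycles of length `j` of the weighted digraph with adjacency matrix `A`, encoded as
permutations, so that loops do not count. -/
noncomputable def cyclesOfLength (A : Matrix ι ι R) (j : ℕ) : Finset (Equiv.Perm ι) :=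
  open Classical in {c | IsPosCycle A c ∧ #c.support = j}

/-- Two cycles of the digraph of `A` are adjacent when they are vertex-disjoint. -/
def disjointCycleGraph (A : Matrix ι ι R) : SimpleGraph (Equiv.Perm ι) where
  Adj c d := IsPosCycle A c ∧ IsPosCycle A d ∧ c.Disjoint d
  symm := ⟨fun _ _ h => ⟨h.2.1, h.1, h.2.2.symm⟩⟩
  loopless := ⟨fun _ h => h.1.isCycle.ne_one (Equiv.Perm.disjoint_refl_iff.mp h.2.2)⟩

noncomputable instance (A : Matrix ι ι R) : DecidableRel (disjointCycleGraph A).Adj :=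
  Classical.decRel _

/-- Every cycle of length at least two in the digraph of `A` has length at least `g`. -/
def HasGirthAtLeast (A : Matrix ι ι R) (g : ℕ) : Prop :=
  ∀ c, IsPosCycle A c → g ≤ #c.support

/-- The linear subdigraphs of the digraph of `A` that consist of `r` disjoint cycles and have `j`
vertices, encoded as permutations. -/
noncomputable def linearSubdigraphs (A : Matrix ι ι R) (j r : ℕ) : Finset (Equiv.Perm ι) :=
  open Classical in {σ | #σ.support = j ∧ Multiset.card σ.cycleType = r ∧ 0 < permWeight A σ}

variable {A : Matrix ι ι R} {g j r : ℕ} {c d σ : Equiv.Perm ι}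

theorem isPosCycle_iff : IsPosCycle A c ↔ c.IsCycle ∧ 0 < permWeight A c :=
  ⟨fun h => ⟨h.isCycle, h.permWeight_pos⟩, fun h => ⟨h.1, h.2⟩⟩

theorem mem_linearSubdigraphs : σ ∈ linearSubdigraphs A j r ↔
    #σ.support = j ∧ Multiset.card σ.cycleType = r ∧ 0 < permWeight A σ := by
  simp [linearSubdigraphs]

theorem linearSubdigraphs_zero (A : Matrix ι ι R) (hj : j ≠ 0) :
    linearSubdigraphs A j 0 = ∅ := by
  refine eq_empty_of_forall_notMem fun σ hσ => hj ?_
  obtain ⟨rfl, hσ, -⟩ := mem_linearSubdigraphs.mp hσ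
  rw [Equiv.Perm.card_cycleType_eq_zero.mp hσ, Equiv.Perm.support_one, card_empty]

theorem mem_cyclesOfLength : c ∈ cyclesOfLength A j ↔ IsPosCycle A c ∧ #c.support = j := by
  simp [cyclesOfLength]

theorem linearSubdigraphs_one (A : Matrix ι ι R) (j : ℕ) :
    linearSubdigraphs A j 1 = cyclesOfLength A j := by
  ext σ
  rw [mem_linearSubdigraphs, mem_cyclesOfLength, Equiv.Perm.card_cycleType_eq_one, and_comm,
    isPosCycle_iff]

theorem permWeight_pos_of_mem_cyclesOfLength (hc : c ∈ cyclesOfLength A j) :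
    0 < permWeight A c :=
  (mem_cyclesOfLength.mp hc).1.permWeight_pos

theorem HasGirthAtLeast.cyclesOfLength_eq_empty (hg : HasGirthAtLeast A g) (hj : j < g) :
    cyclesOfLength A j = ∅ := by
  refine eq_empty_of_forall_notMem fun c hc => ?_
  rw [mem_cyclesOfLength] at hc
  have := hg c hc.1
  omega

theorem HasGirthAtLeast.cliqueFree_disjointCycleGraph (hg : HasGirthAtLeast A g)
    (hι : Fintype.card ι < 3 * g) : (disjointCycleGraph A).CliqueFree 3 := by
  intro s hs
  obtain ⟨c, d, e, hcd, hce, hde, -⟩ := SimpleGraph.is3Clique_iff.mp hs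
  have hsupp : (c * d * e).support.card = #c.support + #d.support + #e.support := by
    rw [(hce.2.2.mul_left hde.2.2).card_support_mul, hcd.2.2.card_support_mul]
  have := (c * d * e).support.card_le_univ
  have := hg c hcd.1
  have := hg d hcd.2.1
  have := hg e hce.2.1
  omega

theorem cycleFactorsFinset_mul_of_adj (h : (disjointCycleGraph A).Adj c d) :
    (c * d).cycleFactorsFinset = {c, d} := by
  rw [h.2.2.cycleFactorsFinset_mul_eq_union, h.1.isCycle.cycleFactorsFinset_eq_singleton,
    h.2.1.isCycle.cycleFactorsFinset_eq_singleton]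
  rfl

variable [IsStrictOrderedRing R]

theorem permWeight_nonneg (hA : ∀ i j, 0 ≤ A i j) (σ : Equiv.Perm ι) : 0 ≤ permWeight A σ :=
  prod_nonneg fun _ _ => hA _ _

theorem sum_permWeight_cyclesOfLength_nonneg (A : Matrix ι ι R) (j : ℕ) :
    0 ≤ ∑ c ∈ cyclesOfLength A j, permWeight A c :=
  sum_nonneg fun _ hc => (permWeight_pos_of_mem_cyclesOfLength hc).le

theorem cyclesOfLength_eq_empty_of_sum_eq_zero
    (h : ∑ c ∈ cyclesOfLength A j, permWeight A c = 0) : cyclesOfLength A j = ∅ := by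
  by_contra hne
  exact h.not_gt (sum_pos (fun _ => permWeight_pos_of_mem_cyclesOfLength)
    (nonempty_iff_ne_empty.mpr hne))

theorem permWeight_pos_iff (hA : ∀ i j, 0 ≤ A i j) :
    0 < permWeight A σ ↔ ∀ i ∈ σ.support, 0 < A i (σ i) :=
  ⟨fun h _ hi => (hA _ _).lt_of_ne' fun h0 => h.ne' (prod_eq_zero hi h0), prod_pos⟩

theorem isPosCycle_of_mem_cycleFactorsFinset (hA : ∀ i j, 0 ≤ A i j) (hσ : 0 < permWeight A σ)
    (hc : c ∈ σ.cycleFactorsFinset) : IsPosCycle A c := by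
  obtain ⟨hcyc, heq⟩ := Equiv.Perm.mem_cycleFactorsFinset_iff.mp hc
  refine ⟨hcyc, (permWeight_pos_iff hA).mpr fun i hi => ?_⟩
  rw [heq i hi]
  exact (permWeight_pos_iff hA).mp hσ i
    (Equiv.Perm.mem_cycleFactorsFinset_support_le hc hi)

theorem HasGirthAtLeast.card_cycleType_mul_le (hg : HasGirthAtLeast A g) (hA : ∀ i j, 0 ≤ A i j)
    (hσ : 0 < permWeight A σ) : Multiset.card σ.cycleType * g ≤ #σ.support := by
  rw [← Equiv.Perm.sum_cycleType, ← smul_eq_mul]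
  refine Multiset.card_nsmul_le_sum fun n hn => ?_
  rw [Equiv.Perm.cycleType_def, Multiset.mem_map] at hn
  obtain ⟨c, hc, rfl⟩ := hn
  exact hg c (isPosCycle_of_mem_cycleFactorsFinset hA hσ hc)

theorem HasGirthAtLeast.charpoly_coeff_eq_sum_linearSubdigraphs (hg : HasGirthAtLeast A g)
    (hA : ∀ i j, 0 ≤ A i j) (hdiag : ∀ i, A i i = 0) (hj : j ≤ Fintype.card ι) {m : ℕ}
    (hjm : j < m * g) :
    A.charpoly.coeff (Fintype.card ι - j) =
      ∑ r ∈ range m, (-1) ^ r * ∑ σ ∈ linearSubdigraphs A j r, permWeight A σ := by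
  classical
  rw [charpoly_coeff_eq_sum_permWeight hdiag hj]
  have hpos : ∑ σ : Equiv.Perm ι with #σ.support = j ∧ 0 < permWeight A σ,
        (-1) ^ Multiset.card σ.cycleType * permWeight A σ =
      ∑ σ : Equiv.Perm ι with #σ.support = j,
        (-1) ^ Multiset.card σ.cycleType * permWeight A σ := by
    rw [← filter_filter]
    refine sum_filter_of_ne fun σ _ hσ => (permWeight_nonneg hA σ).lt_of_ne' ?_
    exact right_ne_zero_of_mul hσ
  rw [← hpos, ← sum_fiberwise_of_maps_to (t := range m)
    (g := fun σ : Equiv.Perm ι => Multiset.card σ.cycleType)]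
  · refine sum_congr rfl fun r _ => ?_
    rw [mul_sum]
    refine sum_congr ?_ fun σ hσ => by rw [(mem_linearSubdigraphs.mp hσ).2.1]
    ext σ
    simp only [mem_filter, mem_univ, true_and, mem_linearSubdigraphs]
    tauto
  · intro σ hσ
    obtain ⟨hcard, hσ⟩ := (mem_filter_univ _).mp hσ
    rw [mem_range]
    exact lt_of_mul_lt_mul_right
      ((hg.card_cycleType_mul_le hA hσ).trans_lt (hcard.trans_lt hjm)) g.zero_le

theorem HasGirthAtLeast.charpoly_coeff_of_lt_two_mul (hg : HasGirthAtLeast A g)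
    (hA : ∀ i j, 0 ≤ A i j) (hdiag : ∀ i, A i i = 0) (hj : j ≠ 0) (hjg : j < 2 * g)
    (hjι : j ≤ Fintype.card ι) :
    A.charpoly.coeff (Fintype.card ι - j) = -∑ c ∈ cyclesOfLength A j, permWeight A c := by
  simp [hg.charpoly_coeff_eq_sum_linearSubdigraphs hA hdiag hjι hjg, sum_range_succ,
    linearSubdigraphs_zero A hj, linearSubdigraphs_one]

theorem hasGirthAtLeast_of_charpoly_coeff_eq_zero (hA : ∀ i j, 0 ≤ A i j)
    (hdiag : ∀ i, A i i = 0)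
    (hcoeff : ∀ j, 1 ≤ j → j < g → j ≤ Fintype.card ι → A.charpoly.coeff (Fintype.card ι - j) = 0) :
    HasGirthAtLeast A g := by
  induction g with
  | zero => exact fun _ _ => zero_le
  | succ g ih =>
    have hg : HasGirthAtLeast A g := ih fun j h1 hj => hcoeff j h1 (hj.trans g.lt_succ_self)
    intro c hc
    refine Nat.succ_le_of_lt ((hg c hc).lt_of_ne fun hcard => ?_)
    have h2 := hc.isCycle.two_le_card_support
    have hι := c.support.card_le_univ
    have hsum := hg.charpoly_coeff_of_lt_two_mul hA hdiag (j := g) (by omega) (by omega) (by omega)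
    rw [hcoeff g (by omega) g.lt_succ_self (by omega), eq_comm, neg_eq_zero] at hsum
    exact notMem_empty c
      (cyclesOfLength_eq_empty_of_sum_eq_zero hsum ▸ mem_cyclesOfLength.mpr ⟨hc, hcard.symm⟩)

theorem mul_mem_linearSubdigraphs (h : (disjointCycleGraph A).Adj c d) :
    c * d ∈ linearSubdigraphs A (#c.support + #d.support) 2 := by
  rw [mem_linearSubdigraphs, h.2.2.card_support_mul, permWeight_mul A h.2.2,
    h.2.2.cycleType_mul, Multiset.card_add, Equiv.Perm.card_cycleType_eq_one.mpr h.1.isCycle,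
    Equiv.Perm.card_cycleType_eq_one.mpr h.2.1.isCycle]
  exact ⟨rfl, rfl, mul_pos h.1.permWeight_pos h.2.1.permWeight_pos⟩

theorem mem_offDiag_cycleFactorsFinset_iff (hA : ∀ i j, 0 ≤ A i j)
    (hσ : σ ∈ linearSubdigraphs A j 2) :
    (c, d) ∈ σ.cycleFactorsFinset.offDiag ↔ (disjointCycleGraph A).Adj c d ∧ c * d = σ := by
  obtain ⟨-, hcard, hpos⟩ := mem_linearSubdigraphs.mp hσ
  rw [mem_offDiag]
  constructor
  · rintro ⟨hc, hd, hcd⟩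
    have hadj : (disjointCycleGraph A).Adj c d :=
      ⟨isPosCycle_of_mem_cycleFactorsFinset hA hpos hc,
        isPosCycle_of_mem_cycleFactorsFinset hA hpos hd,
        Equiv.Perm.cycleFactorsFinset_pairwise_disjoint σ hc hd hcd⟩
    refine ⟨hadj, Equiv.Perm.cycleFactorsFinset_injective ?_⟩
    rw [cycleFactorsFinset_mul_of_adj hadj]
    refine eq_of_subset_of_card_le (by simp [insert_subset_iff, hc, hd]) ?_
    rw [card_pair hcd]
    rw [Equiv.Perm.cycleType_def, Multiset.card_map, card_val] at hcard
    exact hcard.le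
  · rintro ⟨hadj, rfl⟩
    simp [cycleFactorsFinset_mul_of_adj hadj, hadj.ne]

theorem sum_disjoint_pairs_permWeight (hA : ∀ i j, 0 ≤ A i j) (j : ℕ) :
    ∑ q : Equiv.Perm ι × Equiv.Perm ι with
        (disjointCycleGraph A).Adj q.1 q.2 ∧ #q.1.support + #q.2.support = j,
        permWeight A q.1 * permWeight A q.2 =
      2 * ∑ σ ∈ linearSubdigraphs A j 2, permWeight A σ := by
  rw [← sum_fiberwise_of_maps_to (t := linearSubdigraphs A j 2) (g := fun q => q.1 * q.2), mul_sum]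
  · refine sum_congr rfl fun σ hσ => ?_
    obtain ⟨hj, hcard, -⟩ := mem_linearSubdigraphs.mp hσ
    have hfiber : univ.filter (fun q : Equiv.Perm ι × Equiv.Perm ι =>
        ((disjointCycleGraph A).Adj q.1 q.2 ∧ #q.1.support + #q.2.support = j) ∧ q.1 * q.2 = σ) =
          σ.cycleFactorsFinset.offDiag := by
      ext ⟨c, d⟩
      rw [mem_filter_univ, mem_offDiag_cycleFactorsFinset_iff hA hσ, and_assoc]
      refine and_congr_right fun hadj => and_iff_right_of_imp ?_
      rintro rfl
      rw [← hadj.2.2.card_support_mul, hj]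
    have hterm : ∀ q ∈ σ.cycleFactorsFinset.offDiag,
        permWeight A q.1 * permWeight A q.2 = permWeight A σ := by
      intro q hq
      obtain ⟨hadj, rfl⟩ := (mem_offDiag_cycleFactorsFinset_iff hA hσ).mp hq
      exact (permWeight_mul A hadj.2.2).symm
    rw [Equiv.Perm.cycleType_def, Multiset.card_map, card_val] at hcard
    rw [filter_filter, hfiber, sum_congr rfl hterm, sum_const, offDiag_card, hcard, nsmul_eq_mul]
    norm_num
  · rintro ⟨c, d⟩ hq
    obtain ⟨hadj, rfl⟩ := (mem_filter_univ _).mp hq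
    exact mul_mem_linearSubdigraphs hadj

theorem sum_antidiagonal_edgeWeight (hA : ∀ i j, 0 ≤ A i j) (j : ℕ) :
    ∑ n ∈ antidiagonal j, edgeWeight (disjointCycleGraph A) (permWeight A)
        (cyclesOfLength A n.1) (cyclesOfLength A n.2) =
      2 * ∑ σ ∈ linearSubdigraphs A j 2, permWeight A σ := by
  rw [← sum_disjoint_pairs_permWeight hA, ← sum_fiberwise_of_maps_to (t := antidiagonal j)
    (g := fun q : Equiv.Perm ι × Equiv.Perm ι => (#q.1.support, #q.2.support))]
  · refine sum_congr rfl fun n hn => ?_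
    rw [edgeWeight_eq_sum_product]
    refine sum_congr ?_ fun _ _ => rfl
    ext ⟨c, d⟩
    rw [HasAntidiagonal.mem_antidiagonal] at hn
    simp only [mem_filter, mem_univ, mem_product, mem_cyclesOfLength, Prod.ext_iff, true_and]
    constructor
    · rintro ⟨⟨⟨-, hc⟩, -, hd⟩, hadj⟩
      exact ⟨⟨hadj, by rw [hc, hd, hn]⟩, hc, hd⟩
    · rintro ⟨⟨hadj, -⟩, hc, hd⟩
      exact ⟨⟨⟨hadj.1, hc⟩, hadj.2.1, hd⟩, hadj⟩
  · exact fun q hq => HasAntidiagonal.mem_antidiagonal.mpr ((mem_filter_univ _).mp hq).2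

theorem HasGirthAtLeast.two_mul_charpoly_coeff_of_lt_three_mul (hg : HasGirthAtLeast A g)
    (hA : ∀ i j, 0 ≤ A i j) (hdiag : ∀ i, A i i = 0) (hj : j ≠ 0) (hjg : j < 3 * g)
    (hjι : j ≤ Fintype.card ι) :
    2 * A.charpoly.coeff (Fintype.card ι - j) =
      ∑ q ∈ antidiagonal j, edgeWeight (disjointCycleGraph A) (permWeight A)
        (cyclesOfLength A q.1) (cyclesOfLength A q.2) -
      2 * ∑ c ∈ cyclesOfLength A j, permWeight A c := by
  rw [hg.charpoly_coeff_eq_sum_linearSubdigraphs hA hdiag hjι hjg,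
    sum_antidiagonal_edgeWeight hA]
  simp only [sum_range_succ, sum_range_zero, linearSubdigraphs_zero A hj, linearSubdigraphs_one,
    sum_empty]
  ring

theorem HasGirthAtLeast.two_mul_charpoly_coeff_two_mul (hg : HasGirthAtLeast A g)
    (hA : ∀ i j, 0 ≤ A i j) (hdiag : ∀ i, A i i = 0) (hg0 : g ≠ 0)
    (hgι : 2 * g ≤ Fintype.card ι) :
    2 * A.charpoly.coeff (Fintype.card ι - 2 * g) =
      edgeWeight (disjointCycleGraph A) (permWeight A) (cyclesOfLength A g) (cyclesOfLength A g) -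
        2 * ∑ c ∈ cyclesOfLength A (2 * g), permWeight A c := by
  rw [hg.two_mul_charpoly_coeff_of_lt_three_mul hA hdiag (by omega) (by omega) hgι]
  congr 1
  refine sum_eq_single_of_mem (g, g) (HasAntidiagonal.mem_antidiagonal.mpr (two_mul g).symm) ?_
  rintro ⟨i, l⟩ hil hne
  rw [HasAntidiagonal.mem_antidiagonal] at hil
  have hshort : i < g ∨ l < g := by
    by_contra! hle
    exact hne (Prod.ext (by omega) (by omega))
  rcases hshort with h | h <;> simp [edgeWeight, hg.cyclesOfLength_eq_empty h]

theorem HasGirthAtLeast.charpoly_coeff_two_mul_add_one (hg : HasGirthAtLeast A g)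
    (hA : ∀ i j, 0 ≤ A i j) (hdiag : ∀ i, A i i = 0) (hg2 : 2 ≤ g)
    (hgι : 2 * g + 1 ≤ Fintype.card ι) :
    A.charpoly.coeff (Fintype.card ι - (2 * g + 1)) =
      edgeWeight (disjointCycleGraph A) (permWeight A) (cyclesOfLength A (g + 1))
          (cyclesOfLength A g) -
        ∑ c ∈ cyclesOfLength A (2 * g + 1), permWeight A c := by
  have hpairs : ∑ q ∈ antidiagonal (2 * g + 1), edgeWeight (disjointCycleGraph A) (permWeight A)
      (cyclesOfLength A q.1) (cyclesOfLength A q.2) =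
        ∑ q ∈ {(g + 1, g), (g, g + 1)}, edgeWeight (disjointCycleGraph A) (permWeight A)
          (cyclesOfLength A q.1) (cyclesOfLength A q.2) := by
    refine (sum_subset ?_ ?_).symm
    · simp only [insert_subset_iff, singleton_subset_iff, HasAntidiagonal.mem_antidiagonal]
      omega
    · rintro ⟨i, l⟩ hil hne
      rw [HasAntidiagonal.mem_antidiagonal] at hil
      simp only [mem_insert, mem_singleton, Prod.mk.injEq] at hne
      have hshort : i < g ∨ l < g := by omega
      rcases hshort with h | h <;> simp [edgeWeight, hg.cyclesOfLength_eq_empty h]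
  refine mul_left_cancel₀ (two_ne_zero (α := R)) ?_
  rw [hg.two_mul_charpoly_coeff_of_lt_three_mul hA hdiag (by omega) (by omega) hgι, hpairs,
    sum_pair (by simp), edgeWeight_comm _ _ (cyclesOfLength A g)]
  ring

end CycleWeights

section Connectivity

theorem exists_nodup_isChain_of_reflTransGen {α : Type*} {r : α → α → Prop} {a b : α}
    (h : Relation.ReflTransGen r a b) :
    ∃ l : List α, (a :: l).IsChain r ∧ (a :: l).Nodup ∧
      (a :: l).getLast (List.cons_ne_nil a l) = b := by
  induction h using Relation.ReflTransGen.head_induction_on with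
  | refl => exact ⟨[], by simp⟩
  | @head a c hac _ ih =>
    obtain ⟨l, hch, hnd, hlast⟩ := ih
    by_cases ha : a ∈ c :: l
    · obtain ⟨s, t, hst⟩ := List.append_of_mem ha
      simp only [hst] at hch hnd hlast
      refine ⟨t, hch.right_of_append, (List.nodup_append.mp hnd).2.1, ?_⟩
      rwa [List.getLast_append_of_ne_nil] at hlast
    · exact ⟨c :: l, List.isChain_cons_cons.mpr ⟨hac, hch⟩, List.nodup_cons.mpr ⟨ha, hnd⟩, hlast⟩

theorem exists_boundary_of_reflTransGen {α : Type*} {r : α → α → Prop} {a b : α}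
    (h : Relation.ReflTransGen r a b) {V : Set α} (ha : a ∈ V) (hb : b ∉ V) :
    ∃ u ∈ V, ∃ v ∉ V, r u v := by
  by_contra! hclosed
  have hmem : ∀ w, Relation.ReflTransGen r a w → w ∈ V := by
    intro w hw
    induction hw with
    | refl => exact ha
    | tail _ huv hu => exact of_not_not fun hv => hclosed _ hu _ hv huv
  exact hb (hmem b h)

variable {ι R : Type*} [CommRing R] [LinearOrder R] {A : Matrix ι ι R}

theorem isIrreducible_of_transGen (hA : ∀ i j, 0 ≤ A i j)
    (h : ∀ i j, Relation.TransGen (0 < A · ·) i j) : A.IsIrreducible := by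
  let : Quiver ι := A.toQuiver
  refine ⟨hA, fun i j => ?_⟩
  induction h i j with
  | single e => exact ⟨Quiver.Path.nil.cons ⟨e⟩, Nat.succ_pos _⟩
  | tail _ e ih =>
    obtain ⟨w, -⟩ := ih
    exact ⟨w.cons ⟨e⟩, Nat.succ_pos _⟩

theorem reflTransGen_of_isIrreducible (hA : A.IsIrreducible) (i j : ι) :
    Relation.ReflTransGen (fun i j => 0 < A i j) i j := by
  let : Quiver ι := A.toQuiver
  obtain ⟨q, -⟩ := hA.connected i j
  induction q with
  | nil => exact .refl
  | cons _ e ih => exact ih.tail e.down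

variable [IsStrictOrderedRing R] [Fintype ι] [DecidableEq ι]

theorem permWeight_formPerm_pos {v : ι} {l : List ι} (hchain : (v :: l).IsChain (0 < A · ·))
    (hnodup : (v :: l).Nodup) (hback : 0 < A ((v :: l).getLast (List.cons_ne_nil v l)) v) :
    0 < permWeight A (v :: l).formPerm := by
  refine prod_pos fun i hi => ?_
  obtain ⟨m, hm, rfl⟩ := List.getElem_of_mem (List.mem_of_formPerm_apply_ne
    (Equiv.Perm.mem_support.mp hi))
  obtain hm' | hm' := Nat.lt_or_ge (m + 1) (v :: l).length
  · rw [List.formPerm_apply_lt_getElem _ hnodup m hm']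
    exact List.isChain_iff_getElem.mp hchain m hm'
  · have hlast : (v :: l)[m] = (v :: l).getLast (List.cons_ne_nil v l) := by
      rw [List.getLast_eq_getElem]
      congr 1
      omega
    rwa [hlast, List.formPerm_apply_getLast]

theorem exists_isPosCycle_of_arc {u v : ι} (huv : u ≠ v) (harc : 0 < A u v)
    (hback : Relation.ReflTransGen (0 < A · ·) v u) :
    ∃ c, IsPosCycle A c ∧ u ∈ c.support ∧ v ∈ c.support := by
  obtain ⟨l, hchain, hnodup, rfl⟩ := exists_nodup_isChain_of_reflTransGen hback
  have hl : l ≠ [] := by rintro rfl; exact huv rfl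
  have hsupp : (v :: l).formPerm.support = (v :: l).toFinset :=
    List.support_formPerm_of_nodup _ hnodup (by simpa using hl)
  refine ⟨(v :: l).formPerm, ⟨List.isCycle_formPerm hnodup ?_,
    permWeight_formPerm_pos hchain hnodup harc⟩, ?_, ?_⟩
  · simpa [Nat.succ_le_iff, List.length_pos_iff] using hl
  · rw [hsupp, List.mem_toFinset]
    exact List.getLast_mem _
  · rw [hsupp, List.mem_toFinset]
    exact List.mem_cons_self

theorem not_isIrreducible_of_separated {S : Set (Equiv.Perm ι)} {c d : Equiv.Perm ι}
    (hsep : ∀ e ∈ S, ∀ f ∉ S, IsPosCycle A f → e.Disjoint f) (hc : c ∈ S) (hc1 : c ≠ 1)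
    (hd : d ∉ S) (hdpos : IsPosCycle A d) : ¬ A.IsIrreducible := by
  intro hirr
  let V : Set ι := {v | ∃ e ∈ S, v ∈ e.support}
  have hout : ∀ f ∉ S, IsPosCycle A f → ∀ v ∈ f.support, v ∉ V := by
    rintro f hf hfpos v hv ⟨e, he, hve⟩
    exact Finset.disjoint_left.mp (hsep e he f hf hfpos).disjoint_support hve hv
  obtain ⟨i, hi⟩ := nonempty_iff_ne_empty.mpr (mt Equiv.Perm.support_eq_empty_iff.mp hc1)
  obtain ⟨j, hj⟩ := hdpos.isCycle.nonempty_support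
  obtain ⟨u, hu, v, hv, huv⟩ := exists_boundary_of_reflTransGen
    (reflTransGen_of_isIrreducible hirr i j) (V := V) ⟨c, hc, hi⟩ (hout d hd hdpos j hj)
  obtain ⟨f, hf, huf, hvf⟩ := exists_isPosCycle_of_arc (by rintro rfl; exact hv hu) huv
    (reflTransGen_of_isIrreducible hirr v u)
  by_cases hfS : f ∈ S
  · exact hv ⟨f, hfS, hvf⟩
  · exact hout f hfS hf u huf hu

end Connectivity

section SimpleEBL

section Charpoly

variable {R : Type*} [CommRing R]

/-- The EBL digraph consisting of the path `0 → 1 → ⋯ → n - 1` with weights one, an arc of weight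
`u r` from the `r`-th vertex to the first one, closing a cycle of length `r`, and an arc of weight
`v r` from the last vertex to the `r`-th last one, also closing a cycle of length `r`. -/
def eblMatrix (n : ℕ) (u v : ℕ → R) : Matrix (Fin n) (Fin n) R := fun i j =>
  (if (j : ℕ) = i + 1 then 1 else 0) + (if (j : ℕ) = 0 then u (i + 1) else 0) +
    if (i : ℕ) + 1 = n then v (n - j) else 0

/-- The polynomial `x^m - u_1 x^(m-1) - ⋯ - u_m`, the characteristic polynomial of the first `m`
vertices of an EBL digraph. -/
noncomputable def eblInitialPoly (u : ℕ → R) : ℕ → R[X]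
  | 0 => 1
  | m + 1 => X * eblInitialPoly u m - C (u (m + 1))

theorem coeff_eblInitialPoly (u : ℕ → R) (m j : ℕ) :
    (eblInitialPoly u m).coeff j = if j = m then 1 else if j < m then -u (m - j) else 0 := by
  induction m generalizing j with
  | zero => simp [eblInitialPoly, coeff_one]
  | succ m ih => cases j <;> simp [eblInitialPoly, coeff_C, ih]

theorem charmatrix_eblMatrix_mulVec (n : ℕ) (u v : ℕ → R) (i : Fin n) :
    ((eblMatrix n u v).charmatrix.mulVec fun j => eblInitialPoly u j) i =
      if (i : ℕ) + 1 = n then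
        eblInitialPoly u n - ∑ j ∈ range n, C (v (n - j)) * eblInitialPoly u j
      else 0 := by
  have hpath : ∑ j : Fin n, (if (j : ℕ) = i + 1 then 1 else 0) * eblInitialPoly u j =
      if (i : ℕ) + 1 = n then 0 else eblInitialPoly u (i + 1) := by
    rw [Fin.sum_univ_eq_sum_range (fun j => (if j = i + 1 then 1 else 0) * eblInitialPoly u j)]
    simp only [ite_mul, one_mul, zero_mul, sum_ite_eq', mem_range]
    split_ifs <;> first | rfl | omega
  have hfirst : ∑ j : Fin n, (if (j : ℕ) = 0 then C (u (i + 1)) else 0) * eblInitialPoly u j =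
      C (u (i + 1)) := by
    rw [Fin.sum_univ_eq_sum_range
      (fun j => (if j = 0 then C (u (i + 1)) else 0) * eblInitialPoly u j)]
    simp [i.pos, eblInitialPoly]
  have hlast : ∑ j : Fin n, (if (i : ℕ) + 1 = n then C (v (n - j)) else 0) * eblInitialPoly u j =
      if (i : ℕ) + 1 = n then ∑ j ∈ range n, C (v (n - j)) * eblInitialPoly u j else 0 := by
    rw [Fin.sum_univ_eq_sum_range
      (fun j => (if (i : ℕ) + 1 = n then C (v (n - j)) else 0) * eblInitialPoly u j)]
    split_ifs <;> simp
  have hdiag : ∑ j, Matrix.diagonal (fun _ => X) i j * eblInitialPoly u j =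
      X * eblInitialPoly u i := by
    simp [Matrix.diagonal_apply]
  simp only [Matrix.mulVec, dotProduct, Matrix.charmatrix_apply, eblMatrix, map_add, sub_mul,
    add_mul, sum_sub_distrib, sum_add_distrib, apply_ite C, C_1, C_0, hpath, hfirst, hlast, hdiag]
  split_ifs with h
  · have hn : eblInitialPoly u n = X * eblInitialPoly u i - C (u (i + 1)) :=
      congrArg (eblInitialPoly u) h.symm
    rw [hn]
    ring
  · rw [eblInitialPoly]
    ring

theorem adjugate_charmatrix_eblMatrix (m : ℕ) (u v : ℕ → R) :
    (eblMatrix (m + 1) u v).charmatrix.adjugate 0 (Fin.last m) = 1 := by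
  have hentry : ∀ i j : Fin m, i ≤ j →
      (eblMatrix (m + 1) u v).charmatrix i.castSucc j.succ = if i = j then -1 else 0 := by
    intro i j hij
    have hne : i.castSucc ≠ j.succ := (Fin.castSucc_lt_succ_iff.mpr hij).ne
    rw [Matrix.charmatrix_apply_ne _ _ _ hne]
    rcases hij.eq_or_lt with rfl | hlt
    · simp [eblMatrix, i.isLt.ne]
    · simp [eblMatrix, i.isLt.ne, hlt.ne, Fin.val_inj, hlt.ne']
  have htri : ((eblMatrix (m + 1) u v).charmatrix.submatrix (Fin.last m).succAbove
      (0 : Fin (m + 1)).succAbove).IsLowerTriangular := by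
    intro i j hij
    have hlt : i < j := hij
    simp [hentry i j hlt.le, hlt.ne]
  rw [Matrix.adjugate_fin_succ_eq_det_submatrix, Matrix.det_of_isLowerTriangular _ htri]
  simp [hentry, ← mul_pow]

theorem charpoly_eblMatrix {n : ℕ} (hn : 0 < n) (u v : ℕ → R) :
    (eblMatrix n u v).charpoly =
      eblInitialPoly u n - ∑ j ∈ range n, C (v (n - j)) * eblInitialPoly u j := by
  obtain ⟨m, rfl⟩ := Nat.exists_eq_succ_of_ne_zero hn.ne'
  set χ := eblInitialPoly u (m + 1) - ∑ j ∈ range (m + 1), C (v (m + 1 - j)) * eblInitialPoly u j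
  set M := (eblMatrix (m + 1) u v).charmatrix
  let Q : Fin (m + 1) → R[X] := fun j => eblInitialPoly u j
  have hMQ : M.mulVec Q = Pi.single (Fin.last m) χ := by
    ext1 i
    rw [charmatrix_eblMatrix_mulVec, Pi.single_apply]
    exact if_congr (by simp [Fin.ext_iff]) rfl rfl
  calc M.det = (M.det • Q) 0 := by simp [Q, eblInitialPoly]
    _ = (M.adjugate.mulVec (M.mulVec Q)) 0 := by
      rw [Matrix.mulVec_mulVec, Matrix.adjugate_mul, Matrix.smul_mulVec, Matrix.one_mulVec]
    _ = χ := by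
      rw [hMQ, Matrix.mulVec_single, Pi.smul_apply, Matrix.col_apply,
        adjugate_charmatrix_eblMatrix]
      simp

theorem coeff_charpoly_eblMatrix {n j : ℕ} (hj : j ≠ 0) (hjn : j ≤ n) (u v : ℕ → R) :
    (eblMatrix n u v).charpoly.coeff (n - j) =
      ∑ r ∈ Ico 1 j, u r * v (j - r) - u j - v j := by
  obtain ⟨d, rfl⟩ := Nat.exists_eq_add_of_le' hjn
  have hlow : ∑ b ∈ range d, v (d + j - b) * (eblInitialPoly u b).coeff d = 0 := by
    refine sum_eq_zero fun b hb => ?_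
    have hb := mem_range.mp hb
    rw [coeff_eblInitialPoly, if_neg hb.ne', if_neg hb.not_gt, mul_zero]
  have hhigh : ∑ r ∈ Ico 1 j, v (d + j - (d + r)) * (eblInitialPoly u (d + r)).coeff d =
      -∑ r ∈ Ico 1 j, u r * v (j - r) := by
    rw [← sum_neg_distrib]
    refine sum_congr rfl fun r hr => ?_
    have hr := mem_Ico.mp hr
    rw [coeff_eblInitialPoly, if_neg (by omega), if_pos (by omega), Nat.add_sub_add_left,
      Nat.add_sub_cancel_left]
    ring
  rw [charpoly_eblMatrix (by omega), coeff_sub, finsetSum_coeff, coeff_eblInitialPoly,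
    if_neg (by omega), if_pos (by omega)]
  simp only [coeff_C_mul, Nat.add_sub_cancel]
  rw [sum_range_add, hlow, range_eq_Ico, sum_eq_sum_Ico_succ_bot (by omega), hhigh, add_zero,
    coeff_eblInitialPoly, if_pos rfl, Nat.add_sub_cancel_left]
  ring

end Charpoly

variable {n : ℕ}

theorem IsDigraphCycle.apply_add_eq {A : Matrix (Fin n) (Fin n) ℝ}
    (harcs : ∀ i j : Fin n, 0 < A i j → (j : ℕ) = i + 1 ∨ (j : ℕ) = 0 ∨ (i : ℕ) + 1 = n)
    {m : ℕ} {c : Fin (m + 1) → Fin n} (hc : IsDigraphCycle A c) {t : Fin (m + 1)}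
    (ht : (c t : ℕ) = 0) (s : Fin (m + 1)) : (c (t + s) : ℕ) = s := by
  induction s using WellFoundedLT.induction with
  | _ s ih =>
    by_cases hs : s = 0
    · simpa [hs] using ht
    have hval := Fin.val_sub_one_of_ne_zero hs
    have hs' := Fin.val_ne_zero_iff.mpr hs
    have hprev := ih (s - 1) (Fin.lt_def.mpr (by omega))
    have harc := harcs _ _ (hc.2 (t + (s - 1)))
    rw [add_assoc, sub_add_cancel] at harc
    by_contra hne
    have hlt : (c (t + s) : ℕ) < s := by omega
    have heq := hc.1 (Fin.ext (ih ⟨_, hlt.trans s.isLt⟩ hlt))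
    exact hlt.ne (congrArg Fin.val (add_left_cancel heq))

theorem IsDigraphCycle.reverse {A : Matrix (Fin n) (Fin n) ℝ} {m : ℕ} {c : Fin (m + 1) → Fin n}
    (hc : IsDigraphCycle A c) :
    IsDigraphCycle (fun i j => A j.rev i.rev) fun s => (c (-s)).rev := by
  refine ⟨fun s t h => neg_injective (hc.1 (Fin.rev_injective h)), fun s => ?_⟩
  have := hc.2 (-(s + 1))
  rw [neg_add_rev, neg_add_cancel_comm] at this
  simpa only [Fin.rev_rev, neg_add_rev] using this

theorem IsDigraphCycle.exists_eq_zero_or_exists_eq_last {A : Matrix (Fin n) (Fin n) ℝ}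
    (harcs : ∀ i j : Fin n, 0 < A i j → (j : ℕ) = i + 1 ∨ (j : ℕ) = 0 ∨ (i : ℕ) + 1 = n)
    {m : ℕ} {c : Fin (m + 1) → Fin n} (hc : IsDigraphCycle A c) :
    (∃ t, (c t : ℕ) = 0) ∨ ∃ t, (c t : ℕ) + 1 = n := by
  obtain ⟨t, ht⟩ := Finite.exists_max fun s => (c s : ℕ)
  rcases harcs _ _ (hc.2 t) with h | h | h
  · have := ht (t + 1)
    omega
  · exact .inl ⟨_, h⟩
  · exact .inr ⟨t, h⟩

theorem IsDigraphCycle.initial_or_final {A : Matrix (Fin n) (Fin n) ℝ}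
    (harcs : ∀ i j : Fin n, 0 < A i j → (j : ℕ) = i + 1 ∨ (j : ℕ) = 0 ∨ (i : ℕ) + 1 = n)
    {m : ℕ} {c : Fin (m + 1) → Fin n} (hc : IsDigraphCycle A c) :
    (∃ t, ∀ s, (c (t + s) : ℕ) = s) ∨ ∃ t, ∀ s, (c (t + s) : ℕ) + (m + 1) = n + s := by
  obtain ⟨t, ht⟩ | ⟨t, ht⟩ := hc.exists_eq_zero_or_exists_eq_last harcs
  · exact .inl ⟨t, hc.apply_add_eq harcs ht⟩
  · -- Reversing all arcs and the order of the vertices swaps the two kinds of cycles.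
    have harcs' : ∀ i j : Fin n, 0 < A j.rev i.rev →
        (j : ℕ) = i + 1 ∨ (j : ℕ) = 0 ∨ (i : ℕ) + 1 = n := by
      intro i j hij
      have := harcs _ _ hij
      simp only [Fin.val_rev] at this
      omega
    have hrev := hc.reverse.apply_add_eq (t := -t) harcs' (by simp [Fin.val_rev, ht])
    refine .inr ⟨t + 1, fun s => ?_⟩
    have hs : -(-t + s.rev) = t + 1 + s := by
      rw [← Fin.last_sub, neg_add, neg_neg, neg_sub, sub_eq_add_neg, Fin.neg_last]
      abel
    have := hrev s.rev
    rw [hs, Fin.val_rev, Fin.val_rev] at this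
    omega

section Arcs

variable {u v : ℕ → ℝ}

theorem eblMatrix_nonneg (hu : ∀ r, 0 ≤ u r) (hv : ∀ r, 0 ≤ v r) (i j : Fin n) :
    0 ≤ eblMatrix n u v i j := by
  have := hu (i + 1)
  have := hv (n - j)
  unfold eblMatrix
  positivity

theorem eblMatrix_eq_one (u v : ℕ → ℝ) {i j : Fin n} (h : (j : ℕ) = i + 1) :
    eblMatrix n u v i j = 1 := by
  have := j.isLt
  rw [eblMatrix, if_pos h, if_neg (by omega), if_neg (by omega), add_zero, add_zero]

theorem isSimpleEBL_eblMatrix (hu : ∀ r, 0 ≤ u r) (hv : ∀ r, 0 ≤ v r) :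
    IsSimpleEBL (eblMatrix n u v) := by
  have harcs : ∀ i j : Fin n, 0 < eblMatrix n u v i j →
      (j : ℕ) = i + 1 ∨ (j : ℕ) = 0 ∨ (i : ℕ) + 1 = n := by
    intro i j h
    by_contra! hno
    simp [eblMatrix, hno] at h
  exact ⟨eblMatrix_nonneg hu hv, fun _ _ => eblMatrix_eq_one u v, harcs,
    fun _ _ hc => hc.initial_or_final harcs⟩

theorem reflTransGen_eblMatrix_of_le {i j : Fin n} (hij : i ≤ j) :
    Relation.ReflTransGen (0 < eblMatrix n u v · ·) i j := by
  obtain ⟨d, hd⟩ := Nat.exists_eq_add_of_le (Fin.le_def.mp hij)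
  induction d generalizing j with
  | zero => rw [show j = i from Fin.ext hd]
  | succ d ih =>
    have hlt : (i : ℕ) + d < n := by omega
    refine (ih (j := ⟨i + d, hlt⟩) (Fin.le_def.mpr (by simp)) rfl).tail ?_
    rw [eblMatrix_eq_one u v (by simpa [add_assoc] using hd)]
    exact one_pos

theorem eblMatrix_to_first_pos (hv : ∀ r, 0 ≤ v r) {i j : Fin n} (hj : (j : ℕ) = 0)
    (h : 0 < u (i + 1)) : 0 < eblMatrix n u v i j := by
  have := hv (n - j)
  rw [eblMatrix, if_pos hj]
  positivity

theorem eblMatrix_from_last_pos (hu : ∀ r, 0 ≤ u r) {i j : Fin n} (hi : (i : ℕ) + 1 = n)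
    (h : 0 < v (n - j)) : 0 < eblMatrix n u v i j := by
  have := hu (i + 1)
  rw [eblMatrix, if_pos hi]
  positivity

theorem transGen_eblMatrix_last_first (hn : 0 < n) (hu : ∀ r, 0 ≤ u r) (hv : ∀ r, 0 ≤ v r)
    {r s : ℕ} (hr : r ≤ n) (hs : s ≤ n) (hrs : n < r + s) (hur : 0 < u r) (hvs : 0 < v s) :
    Relation.TransGen (0 < eblMatrix n u v · ·) ⟨n - 1, Nat.sub_one_lt hn.ne'⟩ ⟨0, hn⟩ := by
  have hleave := eblMatrix_from_last_pos (i := ⟨n - 1, by omega⟩) (j := ⟨n - s, by omega⟩) hu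
    (Nat.sub_add_cancel hn) (by rwa [Nat.sub_sub_self hs])
  have hpath : Relation.ReflTransGen (0 < eblMatrix n u v · ·) (⟨n - s, by omega⟩ : Fin n)
      ⟨r - 1, by omega⟩ :=
    reflTransGen_eblMatrix_of_le (Fin.le_def.mpr (by dsimp only; omega))
  have hreturn := eblMatrix_to_first_pos (i := ⟨r - 1, by omega⟩) (j := ⟨0, hn⟩) hv rfl
    (by rwa [Nat.sub_add_cancel (show 1 ≤ r by omega)])
  exact .head' hleave (hpath.tail hreturn)

theorem isIrreducible_eblMatrix (hu : ∀ r, 0 ≤ u r) (hv : ∀ r, 0 ≤ v r) {r s : ℕ} (hr : r ≤ n)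
    (hs : s ≤ n) (hrs : n < r + s) (hur : 0 < u r) (hvs : 0 < v s) :
    (eblMatrix n u v).IsIrreducible := by
  have hn : 0 < n := by omega
  refine isIrreducible_of_transGen (eblMatrix_nonneg hu hv) fun i j => ?_
  have hfrom := reflTransGen_eblMatrix_of_le (u := u) (v := v) (i := i)
    (j := ⟨n - 1, by omega⟩) (Fin.le_def.mpr (by dsimp only; omega))
  have hto := reflTransGen_eblMatrix_of_le (u := u) (v := v) (i := ⟨0, hn⟩) (j := j)
    (Fin.le_def.mpr j.val.zero_le)
  exact (Relation.TransGen.trans_right hfrom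
    (transGen_eblMatrix_last_first hn hu hv hr hs hrs hur hvs)).trans_left hto

end Arcs

end SimpleEBL

section CoefficientConditions

theorem coeff_oddGapPoly (p : ℕ) (k : ℕ → ℝ) {j : ℕ} (hj : j ≠ 0) (hjp : j ≤ 2 * p + 1) :
    (oddGapPoly p k).coeff (2 * p + 1 - j) = if p ≤ j then k j else 0 := by
  have hterm : ∀ i ∈ Icc p (2 * p + 1),
      (C (k i) * X ^ (2 * p + 1 - i)).coeff (2 * p + 1 - j) = if j = i then k i else 0 := by
    intro i hi
    have hi := (mem_Icc.mp hi).2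
    rw [coeff_C_mul, coeff_X_pow, mul_ite, mul_one, mul_zero]
    exact if_congr (by omega) rfl rfl
  rw [oddGapPoly, coeff_add, coeff_X_pow, if_neg (by omega), zero_add, finsetSum_coeff,
    sum_congr rfl hterm, sum_ite_eq]
  simp [mem_Icc, hjp]

/-- The necessary and sufficient condition for `oddGapPoly p k` to be realizable. The witness `α`
is the largest weight of a set of pairwise intersecting cycles of length `p`. -/
structure FeasibleCoeffs (p : ℕ) (k : ℕ → ℝ) (α : ℝ) : Prop where
  nonpos : ∀ j, p ≤ j → j < 2 * p → k j ≤ 0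
  nonneg : 0 ≤ α
  le : α ≤ -k p
  coeff_two_mul_le : k (2 * p) ≤ α * (-k p - α)
  coeff_two_mul_add_one_le : k (2 * p + 1) ≤ -k (p + 1) * α

/-- The exceptional configurations, parametrized by the only feasible `α`. -/
structure TightCoeffs (p : ℕ) (k : ℕ → ℝ) (α : ℝ) : Prop where
  neg : k p < 0
  nonpos : k (p + 1) ≤ 0
  eq_zero : ∀ j, p + 2 ≤ j → j < 2 * p → k j = 0
  le_two_mul : -k p ≤ 2 * α
  le : α ≤ -k p
  two_mul_eq_iff : 2 * α = -k p ↔ k (p + 1) = 0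
  coeff_two_mul : k (2 * p) = α * (-k p - α)
  coeff_two_mul_add_one : k (2 * p + 1) = -k (p + 1) * α

variable {p : ℕ} {k : ℕ → ℝ} {α s : ℝ}

theorem ExceptionalCoeffs.exists_tightCoeffs (hp : 2 ≤ p) (h : ExceptionalCoeffs p k) :
    ∃ α, TightCoeffs p k α := by
  rcases h with ⟨ha, hb, h0, hn⟩ | ⟨ha, hb, h0, hpos, hlt, hn⟩ | ⟨ha, h0, h2, hn⟩
  · refine ⟨-k p, ha, hb.le, fun j hj hj' => h0 j hj hj'.le, by linarith, le_rfl,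
      ⟨fun h => by linarith, fun h => absurd h hb.ne⟩, ?_, by rw [hn]; ring⟩
    rw [h0 (2 * p) (by omega) le_rfl, sub_self, mul_zero]
  · set q := √(k p ^ 2 / 4 - k (2 * p))
    have hq : q ^ 2 = k p ^ 2 / 4 - k (2 * p) := Real.sq_sqrt (by linarith)
    have hq0 : 0 < q := Real.sqrt_pos.mpr (by linarith)
    have hqa : q < -k p / 2 := by nlinarith
    exact ⟨-k p / 2 + q, ha, hb.le, fun j hj hj' => h0 j hj (by omega), by linarith, by linarith,
      ⟨fun h => by linarith, fun h => absurd h hb.ne⟩, by linear_combination hq, by rw [hn]; ring⟩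
  · have hb : k (p + 1) = 0 := h0 (p + 1) le_rfl (by omega)
    exact ⟨-k p / 2, ha, hb.le, fun j hj hj' => h0 j (by omega) (by omega), by linarith,
      by linarith, iff_of_true (by ring) hb, by rw [h2]; ring, by rw [hn, hb]; ring⟩

theorem TightCoeffs.exceptionalCoeffs (h : TightCoeffs p k α) : ExceptionalCoeffs p k := by
  have hα : 0 < α := by linarith [h.neg, h.le_two_mul]
  rcases h.nonpos.eq_or_lt with hb | hb
  · have hα2 : α = -k p / 2 := by linarith [h.two_mul_eq_iff.mpr hb]
    refine .inr (.inr ⟨h.neg, fun j hj hj' => ?_, ?_, ?_⟩)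
    · obtain rfl | hj := hj.eq_or_lt
      exacts [hb, h.eq_zero j hj (by omega)]
    · rw [h.coeff_two_mul, hα2]
      ring
    · rw [h.coeff_two_mul_add_one, hb, neg_zero, zero_mul]
  rcases h.le.eq_or_lt with ha | ha
  · refine .inl ⟨h.neg, hb, fun j hj hj' => ?_, ?_⟩
    · obtain rfl | hj' := hj'.eq_or_lt
      · rw [h.coeff_two_mul, ha, sub_self, mul_zero]
      · exact h.eq_zero j hj hj'
    · rw [h.coeff_two_mul_add_one, ha, neg_mul_neg, mul_comm]
  · have hα2 : -k p < 2 * α :=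
      h.le_two_mul.lt_of_ne fun he => hb.ne (h.two_mul_eq_iff.mp he.symm)
    have hsqrt : √(k p ^ 2 / 4 - k (2 * p)) = α + k p / 2 := by
      rw [h.coeff_two_mul, ← Real.sqrt_sq (show 0 ≤ α + k p / 2 by linarith)]
      ring_nf
    refine .inr (.inl ⟨h.neg, hb, fun j hj hj' => h.eq_zero j hj (by omega), ?_, ?_, ?_⟩)
    · rw [h.coeff_two_mul]
      exact mul_pos hα (by linarith)
    · rw [h.coeff_two_mul]
      nlinarith
    · rw [h.coeff_two_mul_add_one, hsqrt]
      ring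

theorem TightCoeffs.feasibleCoeffs (h : TightCoeffs p k α) : FeasibleCoeffs p k α where
  nonpos j hj hj' := by
    obtain rfl | hj := hj.eq_or_lt
    · exact h.neg.le
    obtain rfl | hj := (Nat.succ_le_of_lt hj).eq_or_lt
    exacts [h.nonpos, (h.eq_zero j hj hj').le]
  nonneg := by linarith [h.neg, h.le_two_mul]
  le := h.le
  coeff_two_mul_le := h.coeff_two_mul.le
  coeff_two_mul_add_one_le := h.coeff_two_mul_add_one.le

theorem TightCoeffs.eq_of_feasibleCoeffs (ht : TightCoeffs p k s) (hf : FeasibleCoeffs p k α) :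
    α = s := by
  have hprod : 0 ≤ (s - α) * (α + s + k p) := by
    linarith [hf.coeff_two_mul_le, ht.coeff_two_mul]
  rcases ht.nonpos.eq_or_lt with hb | hb
  · have hs : k p = -(2 * s) := by linarith [ht.two_mul_eq_iff.mpr hb]
    rw [hs] at hprod
    nlinarith
  · have hα : 0 ≤ α - s := by
      refine nonneg_of_mul_nonneg_right (a := -k (p + 1)) ?_ (neg_pos.mpr hb)
      linarith [hf.coeff_two_mul_add_one_le, ht.coeff_two_mul_add_one]
    have hs : -k p < 2 * s :=
      ht.le_two_mul.lt_of_ne fun he => hb.ne (ht.two_mul_eq_iff.mp he.symm)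
    nlinarith

end CoefficientConditions

section Necessity

variable {p : ℕ} {k : ℕ → ℝ} {A : Matrix (Fin (2 * p + 1)) (Fin (2 * p + 1)) ℝ}

theorem charpoly_coeff_of_eq_oddGapPoly (hch : A.charpoly = oddGapPoly p k) {j : ℕ} (hj : j ≠ 0)
    (hjp : j ≤ 2 * p + 1) :
    A.charpoly.coeff (Fintype.card (Fin (2 * p + 1)) - j) = if p ≤ j then k j else 0 := by
  rw [hch, Fintype.card_fin, coeff_oddGapPoly p k hj hjp]

theorem diag_eq_zero_of_charpoly_eq_oddGapPoly (hp : 2 ≤ p) (hA : ∀ i j, 0 ≤ A i j)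
    (hch : A.charpoly = oddGapPoly p k) (i : Fin (2 * p + 1)) : A i i = 0 := by
  have htrace : A.trace = 0 := by
    rw [A.trace_eq_neg_charpoly_coeff, charpoly_coeff_of_eq_oddGapPoly hch one_ne_zero (by omega),
      if_neg (by omega), neg_zero]
  exact (sum_eq_zero_iff_of_nonneg fun i _ => hA i i).mp htrace i (mem_univ i)

theorem hasGirthAtLeast_of_charpoly_eq_oddGapPoly (hp : 2 ≤ p) (hA : ∀ i j, 0 ≤ A i j)
    (hch : A.charpoly = oddGapPoly p k) : HasGirthAtLeast A p := by
  refine hasGirthAtLeast_of_charpoly_coeff_eq_zero hA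
    (diag_eq_zero_of_charpoly_eq_oddGapPoly hp hA hch) fun j hj hjp _ => ?_
  rw [charpoly_coeff_of_eq_oddGapPoly hch (by omega) (by omega), if_neg hjp.not_ge]

theorem coeff_eq_neg_sum_cyclesOfLength (hp : 2 ≤ p) (hA : ∀ i j, 0 ≤ A i j)
    (hch : A.charpoly = oddGapPoly p k) {j : ℕ} (hj : p ≤ j) (hjp : j < 2 * p) :
    k j = -∑ c ∈ cyclesOfLength A j, permWeight A c := by
  rw [← (hasGirthAtLeast_of_charpoly_eq_oddGapPoly hp hA hch).charpoly_coeff_of_lt_two_mul hA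
    (diag_eq_zero_of_charpoly_eq_oddGapPoly hp hA hch) (by omega) hjp
    (by rw [Fintype.card_fin]; omega),
    charpoly_coeff_of_eq_oddGapPoly hch (by omega) (by omega), if_pos hj]

theorem two_mul_coeff_two_mul_eq (hp : 2 ≤ p) (hA : ∀ i j, 0 ≤ A i j)
    (hch : A.charpoly = oddGapPoly p k) :
    2 * k (2 * p) =
      edgeWeight (disjointCycleGraph A) (permWeight A) (cyclesOfLength A p) (cyclesOfLength A p) -
        2 * ∑ c ∈ cyclesOfLength A (2 * p), permWeight A c := by
  rw [← (hasGirthAtLeast_of_charpoly_eq_oddGapPoly hp hA hch).two_mul_charpoly_coeff_two_mul hA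
    (diag_eq_zero_of_charpoly_eq_oddGapPoly hp hA hch) (by omega) (by rw [Fintype.card_fin]; omega),
    charpoly_coeff_of_eq_oddGapPoly hch (by omega) (by omega), if_pos (by omega)]

theorem coeff_two_mul_add_one_eq (hp : 2 ≤ p) (hA : ∀ i j, 0 ≤ A i j)
    (hch : A.charpoly = oddGapPoly p k) :
    k (2 * p + 1) =
      edgeWeight (disjointCycleGraph A) (permWeight A) (cyclesOfLength A (p + 1))
          (cyclesOfLength A p) -
        ∑ c ∈ cyclesOfLength A (2 * p + 1), permWeight A c := by
  rw [← (hasGirthAtLeast_of_charpoly_eq_oddGapPoly hp hA hch).charpoly_coeff_two_mul_add_one hA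
    (diag_eq_zero_of_charpoly_eq_oddGapPoly hp hA hch) hp (by rw [Fintype.card_fin]),
    charpoly_coeff_of_eq_oddGapPoly hch (by omega) le_rfl, if_pos (by omega)]

theorem cliqueFree_disjointCycleGraph_of_charpoly_eq_oddGapPoly (hp : 2 ≤ p)
    (hA : ∀ i j, 0 ≤ A i j) (hch : A.charpoly = oddGapPoly p k) :
    (disjointCycleGraph A).CliqueFree 3 :=
  (hasGirthAtLeast_of_charpoly_eq_oddGapPoly hp hA hch).cliqueFree_disjointCycleGraph
    (by rw [Fintype.card_fin]; omega)

theorem IsMaxWeightIndepSet.feasibleCoeffs {I : Finset (Equiv.Perm (Fin (2 * p + 1)))}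
    (hI : IsMaxWeightIndepSet (disjointCycleGraph A) (permWeight A) (cyclesOfLength A p) I)
    (hp : 2 ≤ p) (hA : ∀ i j, 0 ≤ A i j) (hch : A.charpoly = oddGapPoly p k) :
    FeasibleCoeffs p k (∑ c ∈ I, permWeight A c) := by
  have hG := cliqueFree_disjointCycleGraph_of_charpoly_eq_oddGapPoly hp hA hch
  have hpos : ∀ j, ∀ c ∈ cyclesOfLength A j, 0 ≤ permWeight A c := fun j c _ =>
    permWeight_nonneg hA c
  have ha := coeff_eq_neg_sum_cyclesOfLength hp hA hch le_rfl (by omega : p < 2 * p)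
  have hb := coeff_eq_neg_sum_cyclesOfLength hp hA hch p.le_succ (by omega : p + 1 < 2 * p)
  refine ⟨fun j hj hjp => ?_, sum_nonneg fun c _ => permWeight_nonneg hA c, ?_, ?_, ?_⟩
  · rw [coeff_eq_neg_sum_cyclesOfLength hp hA hch hj hjp]
    exact neg_nonpos.mpr (sum_permWeight_cyclesOfLength_nonneg A j)
  · rw [ha, neg_neg]
    exact sum_le_sum_of_subset_of_nonneg hI.subset fun c _ _ => permWeight_nonneg hA c
  · rw [ha, neg_neg]
    linarith [two_mul_coeff_two_mul_eq hp hA hch, hI.edgeWeight_self_le hG (hpos p),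
      sum_permWeight_cyclesOfLength_nonneg A (2 * p)]
  · rw [hb, neg_neg]
    linarith [coeff_two_mul_add_one_eq hp hA hch,
      edgeWeight_le_mul (hpos (p + 1)) fun c _ => hI.sum_adj_le hG c,
      sum_permWeight_cyclesOfLength_nonneg A (2 * p + 1)]

theorem Realizable.exists_feasibleCoeffs (hp : 2 ≤ p)
    (h : Realizable (2 * p + 1) (oddGapPoly p k)) : ∃ α, FeasibleCoeffs p k α := by
  obtain ⟨A, hA, hch⟩ := h
  obtain ⟨I, hI⟩ := exists_isMaxWeightIndepSet (disjointCycleGraph A) (permWeight A)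
    (cyclesOfLength A p)
  exact ⟨_, hI.feasibleCoeffs hp hA hch⟩

variable {s : ℝ}

theorem TightCoeffs.exists_isMaxWeightIndepSet (ht : TightCoeffs p k s) (hp : 2 ≤ p)
    (hA : ∀ i j, 0 ≤ A i j) (hch : A.charpoly = oddGapPoly p k) :
    ∃ I, IsMaxWeightIndepSet (disjointCycleGraph A) (permWeight A) (cyclesOfLength A p) I ∧
      ∑ c ∈ I, permWeight A c = s := by
  obtain ⟨I, hI⟩ := _root_.exists_isMaxWeightIndepSet (disjointCycleGraph A) (permWeight A)
    (cyclesOfLength A p)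
  exact ⟨I, hI, ht.eq_of_feasibleCoeffs (hI.feasibleCoeffs hp hA hch)⟩

theorem TightCoeffs.cyclesOfLength_eq_empty (ht : TightCoeffs p k s) (hp : 2 ≤ p)
    (hA : ∀ i j, 0 ≤ A i j) (hch : A.charpoly = oddGapPoly p k) {j : ℕ} (hj : p + 2 ≤ j)
    (hjp : j ≤ 2 * p + 1) : cyclesOfLength A j = ∅ := by
  have hG := cliqueFree_disjointCycleGraph_of_charpoly_eq_oddGapPoly hp hA hch
  have ha := coeff_eq_neg_sum_cyclesOfLength hp hA hch le_rfl (by omega : p < 2 * p)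
  have hb := coeff_eq_neg_sum_cyclesOfLength hp hA hch p.le_succ (by omega : p + 1 < 2 * p)
  have hpos : ∀ j, ∀ c ∈ cyclesOfLength A j, 0 ≤ permWeight A c := fun j c _ =>
    permWeight_nonneg hA c
  obtain ⟨I, hI, rfl⟩ := ht.exists_isMaxWeightIndepSet hp hA hch
  refine cyclesOfLength_eq_empty_of_sum_eq_zero
    (le_antisymm ?_ (sum_permWeight_cyclesOfLength_nonneg A j))
  obtain hj2 | rfl | rfl : j < 2 * p ∨ j = 2 * p ∨ j = 2 * p + 1 := by omega
  · linarith [coeff_eq_neg_sum_cyclesOfLength hp hA hch (by omega) hj2, ht.eq_zero j hj hj2]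
  · have htwo := ht.coeff_two_mul
    rw [ha, neg_neg] at htwo
    linarith [two_mul_coeff_two_mul_eq hp hA hch, hI.edgeWeight_self_le hG (hpos p)]
  · have hodd := ht.coeff_two_mul_add_one
    rw [hb, neg_neg] at hodd
    linarith [coeff_two_mul_add_one_eq hp hA hch,
      edgeWeight_le_mul (hpos (p + 1)) fun c _ => hI.sum_adj_le hG c]

theorem TightCoeffs.card_support_of_isPosCycle (ht : TightCoeffs p k s) (hp : 2 ≤ p)
    (hA : ∀ i j, 0 ≤ A i j) (hch : A.charpoly = oddGapPoly p k)
    {c : Equiv.Perm (Fin (2 * p + 1))} (hc : IsPosCycle A c) :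
    #c.support = p ∨ #c.support = p + 1 := by
  by_contra! hne
  have hge := hasGirthAtLeast_of_charpoly_eq_oddGapPoly hp hA hch c hc
  have hle := c.support.card_le_univ
  rw [Fintype.card_fin] at hle
  have hempty := ht.cyclesOfLength_eq_empty hp hA hch (j := #c.support) (by omega) hle
  exact notMem_empty c (hempty ▸ mem_cyclesOfLength.mpr ⟨hc, rfl⟩)

theorem TightCoeffs.exists_subset_forall_adj (ht : TightCoeffs p k s) (hp : 2 ≤ p)
    (hA : ∀ i j, 0 ≤ A i j) (hch : A.charpoly = oddGapPoly p k) :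
    ∃ S ⊆ cyclesOfLength A p, ∑ c ∈ S, permWeight A c = s ∧
      (∀ c ∈ cyclesOfLength A p \ S, ∀ d ∈ S, (disjointCycleGraph A).Adj c d) ∧
      ∀ c ∈ cyclesOfLength A (p + 1), ∀ d ∈ S, (disjointCycleGraph A).Adj c d := by
  have hG := cliqueFree_disjointCycleGraph_of_charpoly_eq_oddGapPoly hp hA hch
  have ha := coeff_eq_neg_sum_cyclesOfLength hp hA hch le_rfl (by omega : p < 2 * p)
  have hb := coeff_eq_neg_sum_cyclesOfLength hp hA hch p.le_succ (by omega : p + 1 < 2 * p)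
  have htwo := ht.coeff_two_mul
  have hodd := ht.coeff_two_mul_add_one
  rw [ha, neg_neg] at htwo
  rw [hb, neg_neg] at hodd
  obtain ⟨I, hI, rfl⟩ := ht.exists_isMaxWeightIndepSet hp hA hch
  refine hI.exists_subset_forall_adj hG (fun c hc => permWeight_pos_of_mem_cyclesOfLength hc)
    (fun c hc => permWeight_pos_of_mem_cyclesOfLength hc) ?_ ?_ fun hH => ?_
  · linarith [two_mul_coeff_two_mul_eq hp hA hch, sum_permWeight_cyclesOfLength_nonneg A (2 * p)]
  · linarith [coeff_two_mul_add_one_eq hp hA hch,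
      sum_permWeight_cyclesOfLength_nonneg A (2 * p + 1)]
  · have hHpos := sum_pos (fun c hc => permWeight_pos_of_mem_cyclesOfLength hc) hH
    refine lt_of_le_of_ne (by linarith [ht.le_two_mul]) fun he => ?_
    linarith [ht.two_mul_eq_iff.mp (by linarith)]

theorem TightCoeffs.not_isIrreducible (ht : TightCoeffs p k s) (hp : 2 ≤ p)
    (hch : A.charpoly = oddGapPoly p k) : ¬ A.IsIrreducible := by
  intro hirr
  have hA := hirr.nonneg
  obtain ⟨S, hSF, hSs, hFS, hHS⟩ := ht.exists_subset_forall_adj hp hA hch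
  have ha := coeff_eq_neg_sum_cyclesOfLength hp hA hch le_rfl (by omega : p < 2 * p)
  have hs : 0 < s := by linarith [ht.neg, ht.le_two_mul]
  obtain ⟨c, hc⟩ : S.Nonempty := nonempty_of_sum_ne_zero (hSs.trans_ne hs.ne')
  have hcpos := (mem_cyclesOfLength.mp (hSF hc)).1
  have hsep : ∀ e ∈ S, ∀ f ∉ S, IsPosCycle A f → e.Disjoint f := by
    intro e he f hf hfpos
    rcases ht.card_support_of_isPosCycle hp hA hch hfpos with hcard | hcard
    · exact (hFS f (mem_sdiff.mpr ⟨mem_cyclesOfLength.mpr ⟨hfpos, hcard⟩, hf⟩) e he).2.2.symm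
    · exact (hHS f (mem_cyclesOfLength.mpr ⟨hfpos, hcard⟩) e he).2.2.symm
  obtain ⟨d, hd, hdpos⟩ : ∃ d ∉ S, IsPosCycle A d := by
    rcases (cyclesOfLength A (p + 1)).eq_empty_or_nonempty with hH | ⟨d, hd⟩
    · have hb := coeff_eq_neg_sum_cyclesOfLength hp hA hch p.le_succ (by omega : p + 1 < 2 * p)
      rw [hH, sum_empty, neg_zero] at hb
      have hlt : ∑ c ∈ S, permWeight A c < ∑ c ∈ cyclesOfLength A p, permWeight A c := by
        linarith [ht.two_mul_eq_iff.mpr hb]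
      obtain ⟨d, hd, hdS⟩ := not_subset.mp fun hFS => hlt.ne (by rw [hSF.antisymm hFS])
      exact ⟨d, hdS, (mem_cyclesOfLength.mp hd).1⟩
    · obtain ⟨hdpos, hcard⟩ := mem_cyclesOfLength.mp hd
      exact ⟨d, fun hdS => by simp [(mem_cyclesOfLength.mp (hSF hdS)).2] at hcard, hdpos⟩
  exact not_isIrreducible_of_separated (S := S) hsep hc hcpos.isCycle.ne_one hd hdpos hirr

end Necessity

section Sufficiency

variable {p : ℕ} {k : ℕ → ℝ} {α β : ℝ}

theorem sum_Ico_mul_of_eq_zero_of_lt {R : Type*} [NonUnitalNonAssocSemiring R] {u v : ℕ → R}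
    (hu : ∀ r < p, u r = 0) (hv : ∀ r < p, v r = 0) {j : ℕ} (hj : j < 2 * p) :
    ∑ r ∈ Ico 1 j, u r * v (j - r) = 0 := by
  refine sum_eq_zero fun r _ => ?_
  obtain hr | hr : r < p ∨ j - r < p := by omega
  · rw [hu r hr, zero_mul]
  · rw [hv _ hr, mul_zero]

theorem sum_Ico_two_mul_mul {R : Type*} [NonUnitalNonAssocSemiring R] {u v : ℕ → R} (hp : p ≠ 0)
    (hu : ∀ r < p, u r = 0) (hv : ∀ r < p, v r = 0) :
    ∑ r ∈ Ico 1 (2 * p), u r * v (2 * p - r) = u p * v p := by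
  rw [sum_eq_single_of_mem p (mem_Ico.mpr (by omega)), show 2 * p - p = p by omega]
  intro r _ hrp
  obtain hr | hr : r < p ∨ 2 * p - r < p := by omega
  · rw [hu r hr, zero_mul]
  · rw [hv _ hr, mul_zero]

theorem sum_Ico_two_mul_add_one_mul {R : Type*} [NonUnitalNonAssocSemiring R] {u v : ℕ → R}
    (hp : p ≠ 0) (hu : ∀ r < p, u r = 0) (hv : ∀ r < p, v r = 0) :
    ∑ r ∈ Ico 1 (2 * p + 1), u r * v (2 * p + 1 - r) = u p * v (p + 1) + u (p + 1) * v p := by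
  have hsub : {p, p + 1} ⊆ Ico 1 (2 * p + 1) := by
    simp only [insert_subset_iff, singleton_subset_iff, mem_Ico]
    omega
  rw [← sum_subset hsub, sum_pair (by omega), show 2 * p + 1 - p = p + 1 by omega,
    show 2 * p + 1 - (p + 1) = p by omega]
  intro r _ hrp
  simp only [mem_insert, mem_singleton] at hrp
  obtain hr | hr : r < p ∨ 2 * p + 1 - r < p := by omega
  · rw [hu r hr, zero_mul]
  · rw [hv _ hr, mul_zero]

theorem degree_sum_Icc_C_mul_X_pow_lt {R : Type*} [Semiring R] (hp : p ≠ 0) (k : ℕ → R) :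
    (∑ j ∈ Icc p (2 * p + 1), C (k j) * X ^ (2 * p + 1 - j)).degree < ↑(2 * p + 1) := by
  refine (Polynomial.degree_sum_le _ _).trans_lt
    ((Finset.sup_lt_iff (WithBot.bot_lt_coe _)).mpr fun j hj => ?_)
  have hj := (mem_Icc.mp hj).1
  refine (degree_C_mul_X_pow_le _ _).trans_lt ?_
  exact_mod_cast (by omega : 2 * p + 1 - j < 2 * p + 1)

theorem charpoly_eq_oddGapPoly_of_coeff (hp : p ≠ 0)
    {A : Matrix (Fin (2 * p + 1)) (Fin (2 * p + 1)) ℝ}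
    (h : ∀ j, j ≠ 0 → j ≤ 2 * p + 1 →
      A.charpoly.coeff (2 * p + 1 - j) = if p ≤ j then k j else 0) :
    A.charpoly = oddGapPoly p k := by
  have hdeg := degree_sum_Icc_C_mul_X_pow_lt hp k
  have hmonic : (oddGapPoly p k).Monic := monic_X_pow_add hdeg
  have hnat : (oddGapPoly p k).natDegree = 2 * p + 1 :=
    natDegree_eq_of_degree_eq_some (degree_add_eq_left_of_degree_lt (by simpa using hdeg) |>.trans
      (degree_X_pow _))
  have hnatA : A.charpoly.natDegree = 2 * p + 1 := by
    rw [A.charpoly_natDegree_eq_dim, Fintype.card_fin]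
  ext i
  obtain hi | rfl | hi := lt_trichotomy i (2 * p + 1)
  · obtain ⟨j, rfl, hj, hjp⟩ : ∃ j, i = 2 * p + 1 - j ∧ j ≠ 0 ∧ j ≤ 2 * p + 1 :=
      ⟨2 * p + 1 - i, by omega, by omega, by omega⟩
    rw [h j hj hjp, coeff_oddGapPoly p k hj hjp]
  · exact (hnatA ▸ A.charpoly_monic.coeff_natDegree :).trans (hnat ▸ hmonic.coeff_natDegree).symm
  · rw [coeff_eq_zero_of_natDegree_lt (hnatA.trans_lt hi),
      coeff_eq_zero_of_natDegree_lt (hnat.trans_lt hi)]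

theorem charpoly_eblMatrix_eq_oddGapPoly {u v : ℕ → ℝ} (hp : p ≠ 0) (hu : ∀ r < p, u r = 0)
    (hv : ∀ r < p, v r = 0) (hmid : ∀ j, p ≤ j → j < 2 * p → u j + v j = -k j)
    (htwo : u (2 * p) + v (2 * p) = u p * v p - k (2 * p))
    (hodd : u (2 * p + 1) + v (2 * p + 1) =
      u p * v (p + 1) + u (p + 1) * v p - k (2 * p + 1)) :
    (eblMatrix (2 * p + 1) u v).charpoly = oddGapPoly p k := by
  refine charpoly_eq_oddGapPoly_of_coeff (by omega) fun j hj hjp => ?_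
  rw [coeff_charpoly_eblMatrix hj hjp]
  obtain hj1 | hj1 | rfl | rfl : j < p ∨ (p ≤ j ∧ j < 2 * p) ∨ j = 2 * p ∨ j = 2 * p + 1 := by
    omega
  · rw [if_neg hj1.not_ge, sum_Ico_mul_of_eq_zero_of_lt hu hv (by omega), hu j hj1, hv j hj1,
      sub_zero, sub_zero]
  · rw [if_pos hj1.1, sum_Ico_mul_of_eq_zero_of_lt hu hv hj1.2]
    linarith [hmid j hj1.1 hj1.2]
  · rw [if_pos (by omega), sum_Ico_two_mul_mul (by omega) hu hv]
    linarith
  · rw [if_pos (by omega), sum_Ico_two_mul_add_one_mul (by omega) hu hv]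
    linarith

/-- The numbers `α` and `β` split the weights `-k p` and `-k (p + 1)` of the cycles of length `p`
and `p + 1` between the two ends of an EBL digraph in such a way that the products of the weights
of disjoint cycles are at least `k (2 * p)` and `k (2 * p + 1)`. -/
structure SplitCoeffs (p : ℕ) (k : ℕ → ℝ) (α β : ℝ) : Prop where
  nonpos : ∀ j, p ≤ j → j < 2 * p → k j ≤ 0
  nonneg_left : 0 ≤ α
  le_left : α ≤ -k p
  nonneg_right : 0 ≤ β
  le_right : β ≤ -k (p + 1)
  coeff_two_mul_le : k (2 * p) ≤ α * (-k p - α)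
  coeff_two_mul_add_one_le : k (2 * p + 1) ≤ α * (-k (p + 1) - β) + β * (-k p - α)

/-- The weights of the arcs at one end of the EBL digraph given by a splitting; the other end has
`-k p - α` and `-k (p + 1) - β` in place of `α` and `β`. From `p + 2` on each end gets half of what
is missing in the coefficient. -/
noncomputable def splitWeight (p : ℕ) (k : ℕ → ℝ) (α β : ℝ) (j : ℕ) : ℝ :=
  if j < p then 0
  else if j = p then α
  else if j = p + 1 then β
  else if j < 2 * p then -k j / 2
  else if j = 2 * p then (α * (-k p - α) - k (2 * p)) / 2
  else (α * (-k (p + 1) - β) + β * (-k p - α) - k (2 * p + 1)) / 2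

theorem splitWeight_of_lt {j : ℕ} (hj : j < p) : splitWeight p k α β j = 0 :=
  if_pos hj

theorem splitWeight_self : splitWeight p k α β p = α := by
  simp [splitWeight]

theorem splitWeight_add_one : splitWeight p k α β (p + 1) = β := by
  simp [splitWeight]

theorem splitWeight_of_lt_two_mul {j : ℕ} (hj : p + 2 ≤ j) (hjp : j < 2 * p) :
    splitWeight p k α β j = -k j / 2 := by
  rw [splitWeight, if_neg (by omega), if_neg (by omega), if_neg (by omega), if_pos hjp]

theorem splitWeight_two_mul (hp : 2 ≤ p) :
    splitWeight p k α β (2 * p) = (α * (-k p - α) - k (2 * p)) / 2 := by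
  rw [splitWeight, if_neg (by omega), if_neg (by omega), if_neg (by omega), if_neg (by omega),
    if_pos rfl]

theorem splitWeight_two_mul_add_one (hp : p ≠ 0) : splitWeight p k α β (2 * p + 1) =
    (α * (-k (p + 1) - β) + β * (-k p - α) - k (2 * p + 1)) / 2 := by
  rw [splitWeight, if_neg (by omega), if_neg (by omega), if_neg (by omega), if_neg (by omega),
    if_neg (by omega)]

theorem SplitCoeffs.symm (h : SplitCoeffs p k α β) :
    SplitCoeffs p k (-k p - α) (-k (p + 1) - β) where
  nonpos := h.nonpos
  nonneg_left := sub_nonneg.mpr h.le_left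
  le_left := sub_le_self _ h.nonneg_left
  nonneg_right := sub_nonneg.mpr h.le_right
  le_right := sub_le_self _ h.nonneg_right
  coeff_two_mul_le := by linarith [h.coeff_two_mul_le]
  coeff_two_mul_add_one_le := by linarith [h.coeff_two_mul_add_one_le]

theorem SplitCoeffs.splitWeight_nonneg (h : SplitCoeffs p k α β) (j : ℕ) :
    0 ≤ splitWeight p k α β j := by
  unfold splitWeight
  split_ifs with h1 h2 h3 h4
  · exact le_rfl
  · exact h.nonneg_left
  · exact h.nonneg_right
  · linarith [h.nonpos j (by omega) h4]
  · linarith [h.coeff_two_mul_le]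
  · linarith [h.coeff_two_mul_add_one_le]

/-- The EBL digraph realizing `oddGapPoly p k` given by a splitting of its coefficients. -/
noncomputable def splitMatrix (p : ℕ) (k : ℕ → ℝ) (α β : ℝ) :
    Matrix (Fin (2 * p + 1)) (Fin (2 * p + 1)) ℝ :=
  eblMatrix (2 * p + 1) (splitWeight p k α β) (splitWeight p k (-k p - α) (-k (p + 1) - β))

theorem SplitCoeffs.isSimpleEBL (h : SplitCoeffs p k α β) : IsSimpleEBL (splitMatrix p k α β) :=
  isSimpleEBL_eblMatrix h.splitWeight_nonneg h.symm.splitWeight_nonneg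

theorem charpoly_splitMatrix (hp : 2 ≤ p) (k : ℕ → ℝ) (α β : ℝ) :
    (splitMatrix p k α β).charpoly = oddGapPoly p k := by
  refine charpoly_eblMatrix_eq_oddGapPoly (by omega) (fun _ => splitWeight_of_lt)
    (fun _ => splitWeight_of_lt) (fun j hj hjp => ?_) ?_ ?_
  · obtain rfl | rfl | hj2 : j = p ∨ j = p + 1 ∨ p + 2 ≤ j := by omega
    · simp only [splitWeight_self]
      ring
    · simp only [splitWeight_add_one]
      ring
    · simp only [splitWeight_of_lt_two_mul hj2 hjp]
      ring
  · simp only [splitWeight_self, splitWeight_two_mul hp]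
    ring
  · simp only [splitWeight_self, splitWeight_add_one,
      splitWeight_two_mul_add_one (show p ≠ 0 by omega)]
    ring

theorem SplitCoeffs.isIrreducible_or (h : SplitCoeffs p k α β) (hp : 2 ≤ p) :
    (splitMatrix p k α β).IsIrreducible ∨
      ((β = 0 ∨ β = -k (p + 1)) ∧ (∀ j, p + 2 ≤ j → j < 2 * p → k j = 0) ∧
        k (2 * p) = α * (-k p - α) ∧
        k (2 * p + 1) = α * (-k (p + 1) - β) + β * (-k p - α)) := by
  have hirr : ∀ j, p + 1 ≤ j → j ≤ 2 * p + 1 → 0 < splitWeight p k α β j →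
      0 < splitWeight p k (-k p - α) (-k (p + 1) - β) j → (splitMatrix p k α β).IsIrreducible :=
    fun j hj hjp => isIrreducible_eblMatrix h.splitWeight_nonneg h.symm.splitWeight_nonneg hjp hjp
      (by omega)
  refine or_iff_not_imp_left.mpr fun hred => ⟨?_, fun j hj hjp => ?_, ?_, ?_⟩
  · by_contra! hβ
    have hβ0 := h.nonneg_right.lt_of_ne' hβ.1
    have hβb := sub_pos.mpr (h.le_right.lt_of_ne hβ.2)
    exact hred (hirr (p + 1) le_rfl (by omega) (splitWeight_add_one.symm ▸ hβ0)
      (splitWeight_add_one.symm ▸ hβb))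
  · by_contra hne
    have hneg := (h.nonpos j (by omega) hjp).lt_of_ne hne
    have hpos : ∀ α β, 0 < splitWeight p k α β j := fun α β => by
      rw [splitWeight_of_lt_two_mul hj hjp]
      linarith
    exact hred (hirr j (by omega) (by omega) (hpos _ _) (hpos _ _))
  · by_contra hne
    have hlt := h.coeff_two_mul_le.lt_of_ne hne
    refine hred (hirr (2 * p) (by omega) (by omega) ?_ ?_) <;> rw [splitWeight_two_mul hp] <;>
      linarith
  · by_contra hne
    have hlt := h.coeff_two_mul_add_one_le.lt_of_ne hne
    refine hred (hirr (2 * p + 1) (by omega) le_rfl ?_ ?_) <;>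
      rw [splitWeight_two_mul_add_one (by omega)] <;> linarith

theorem oddGapPoly_eq_X_pow (h : ∀ j, p ≤ j → j ≤ 2 * p + 1 → k j = 0) :
    oddGapPoly p k = X ^ (2 * p + 1) := by
  rw [oddGapPoly, sum_eq_zero, add_zero]
  intro j hj
  obtain ⟨hj, hjp⟩ := mem_Icc.mp hj
  rw [h j hj hjp, C_0, zero_mul]

theorem FeasibleCoeffs.splitCoeffs (h : FeasibleCoeffs p k α) (hp : 2 ≤ p) :
    SplitCoeffs p k α 0 where
  nonpos := h.nonpos
  nonneg_left := h.nonneg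
  le_left := h.le
  nonneg_right := le_rfl
  le_right := neg_nonneg.mpr (h.nonpos (p + 1) (by omega) (by omega))
  coeff_two_mul_le := h.coeff_two_mul_le
  coeff_two_mul_add_one_le := by linarith [h.coeff_two_mul_add_one_le]

theorem FeasibleCoeffs.splitCoeffs_half (h : FeasibleCoeffs p k α) (hp : 2 ≤ p)
    (hodd : k (2 * p + 1) ≤ -k (p + 1) * (-k p / 2)) :
    SplitCoeffs p k (-k p / 2) (-k (p + 1) / 2) where
  nonpos := h.nonpos
  nonneg_left := by linarith [h.nonpos p le_rfl (by omega)]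
  le_left := by linarith [h.nonpos p le_rfl (by omega)]
  nonneg_right := by linarith [h.nonpos (p + 1) (by omega) (by omega)]
  le_right := by linarith [h.nonpos (p + 1) (by omega) (by omega)]
  coeff_two_mul_le := by nlinarith [h.coeff_two_mul_le, sq_nonneg (α + k p / 2)]
  coeff_two_mul_add_one_le := by linarith

theorem SplitCoeffs.isIrreducible_half_or (h : SplitCoeffs p k (-k p / 2) (-k (p + 1) / 2))
    (hp : 2 ≤ p) (hP : oddGapPoly p k ≠ X ^ (2 * p + 1)) :
    (splitMatrix p k (-k p / 2) (-k (p + 1) / 2)).IsIrreducible ∨ TightCoeffs p k (-k p / 2) := by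
  refine (h.isIrreducible_or hp).imp_right fun ⟨hβ, h0, htwo, hodd⟩ => ?_
  have hb : k (p + 1) = 0 := by rcases hβ with hβ | hβ <;> linarith
  have hodd0 : k (2 * p + 1) = 0 := by rw [hodd, hb]; ring
  refine ⟨?_, hb.le, h0, by linarith, h.le_left, iff_of_true (by ring) hb, htwo,
    by rw [hodd0, hb]; ring⟩
  refine (h.nonpos p le_rfl (by omega)).lt_of_ne fun ha => hP (oddGapPoly_eq_X_pow ?_)
  intro j hj hjp
  obtain rfl | rfl | hj2 | rfl | rfl : j = p ∨ j = p + 1 ∨ (p + 2 ≤ j ∧ j < 2 * p) ∨ j = 2 * p ∨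
      j = 2 * p + 1 := by omega
  exacts [ha, hb, h0 j hj2.1 hj2.2, by rw [htwo, ha]; ring, hodd0]

theorem FeasibleCoeffs.isIrreducible_or (h : FeasibleCoeffs p k α) (hp : 2 ≤ p)
    (hodd : -k (p + 1) * (-k p / 2) < k (2 * p + 1)) :
    (splitMatrix p k α 0).IsIrreducible ∨ TightCoeffs p k α := by
  refine ((h.splitCoeffs hp).isIrreducible_or hp).imp_right fun ⟨_, h0, htwo, hlast⟩ => ?_
  have hlt : -k (p + 1) * (-k p / 2) < -k (p + 1) * α := hodd.trans_le h.coeff_two_mul_add_one_le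
  have hb := h.nonpos (p + 1) (by omega) (by omega)
  have hα : -k p / 2 < α := lt_of_mul_lt_mul_left hlt (neg_nonneg.mpr hb)
  have hb0 : k (p + 1) ≠ 0 := fun hb0 => by simp [hb0] at hlt
  exact ⟨by linarith [h.le], hb, h0, by linarith, h.le,
    ⟨fun h => by linarith, fun h => absurd h hb0⟩, htwo, hlast.trans (by ring)⟩

theorem FeasibleCoeffs.exists_isIrreducible_isSimpleEBL (h : FeasibleCoeffs p k α) (hp : 2 ≤ p)
    (hP : oddGapPoly p k ≠ X ^ (2 * p + 1)) (hexc : ¬ ExceptionalCoeffs p k) :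
    ∃ A : Matrix (Fin (2 * p + 1)) (Fin (2 * p + 1)) ℝ,
      A.IsIrreducible ∧ IsSimpleEBL A ∧ A.charpoly = oddGapPoly p k := by
  obtain hodd | hodd := le_or_gt (k (2 * p + 1)) (-k (p + 1) * (-k p / 2))
  · have hs := h.splitCoeffs_half hp hodd
    exact ⟨_, (hs.isIrreducible_half_or hp hP).resolve_right fun ht => hexc ht.exceptionalCoeffs,
      hs.isSimpleEBL, charpoly_splitMatrix hp _ _ _⟩
  · exact ⟨_, (h.isIrreducible_or hp hodd).resolve_right fun ht => hexc ht.exceptionalCoeffs,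
      (h.splitCoeffs hp).isSimpleEBL, charpoly_splitMatrix hp _ _ _⟩

theorem FeasibleCoeffs.realizable (h : FeasibleCoeffs p k α) (hp : 2 ≤ p) :
    Realizable (2 * p + 1) (oddGapPoly p k) :=
  ⟨_, (h.splitCoeffs hp).isSimpleEBL.nonneg, charpoly_splitMatrix hp _ _ _⟩

end Sufficiency

theorem theorem28_general (p : ℕ) (hp : 2 ≤ p) (k : ℕ → ℝ)
    (hP : oddGapPoly p k ≠ X ^ (2 * p + 1)) :
    (¬ ExceptionalCoeffs p k →
      (Realizable (2 * p + 1) (oddGapPoly p k) ↔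
        IrreduciblyRealizable (2 * p + 1) (oddGapPoly p k))) ∧
    (ExceptionalCoeffs p k →
      Realizable (2 * p + 1) (oddGapPoly p k) ∧
        ¬ IrreduciblyRealizable (2 * p + 1) (oddGapPoly p k)) ∧
    (IrreduciblyRealizable (2 * p + 1) (oddGapPoly p k) →
      ∃ A : Matrix (Fin (2 * p + 1)) (Fin (2 * p + 1)) ℝ,
        A.IsIrreducible ∧ IsSimpleEBL A ∧ A.charpoly = oddGapPoly p k) := by
  have hebl (h : Realizable (2 * p + 1) (oddGapPoly p k)) (hexc : ¬ ExceptionalCoeffs p k) :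
      ∃ A : Matrix (Fin (2 * p + 1)) (Fin (2 * p + 1)) ℝ,
        A.IsIrreducible ∧ IsSimpleEBL A ∧ A.charpoly = oddGapPoly p k := by
    obtain ⟨α, hα⟩ := h.exists_feasibleCoeffs hp
    exact hα.exists_isIrreducible_isSimpleEBL hp hP hexc
  have hreal : IrreduciblyRealizable (2 * p + 1) (oddGapPoly p k) →
      Realizable (2 * p + 1) (oddGapPoly p k) := fun ⟨A, hA, hch⟩ => ⟨A, hA.nonneg, hch⟩
  have hnot (hexc : ExceptionalCoeffs p k) :
      ¬ IrreduciblyRealizable (2 * p + 1) (oddGapPoly p k) := by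
    rintro ⟨A, hA, hch⟩
    obtain ⟨α, hα⟩ := hexc.exists_tightCoeffs hp
    exact hα.not_isIrreducible hp hch hA
  refine ⟨fun hexc => ⟨fun h => ?_, hreal⟩, fun hexc => ⟨?_, hnot hexc⟩,
    fun h => hebl (hreal h) fun hexc => hnot hexc h⟩
  · obtain ⟨A, hA, -, hch⟩ := hebl h hexc
    exact ⟨A, hA, hch⟩
  · obtain ⟨α, hα⟩ := hexc.exists_tightCoeffs hp
    exact hα.feasibleCoeffs.realizable hp

theorem theorem28 (p : ℕ) (hp : 3 ≤ p) (k : ℕ → ℝ)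
    (hP : oddGapPoly p k ≠ Polynomial.X ^ (2 * p + 1)) :
    (¬ ExceptionalCoeffs p k →
      (Realizable (2 * p + 1) (oddGapPoly p k) ↔
        IrreduciblyRealizable (2 * p + 1) (oddGapPoly p k))) ∧
    (ExceptionalCoeffs p k →
      Realizable (2 * p + 1) (oddGapPoly p k) ∧
        ¬ IrreduciblyRealizable (2 * p + 1) (oddGapPoly p k)) ∧
    (IrreduciblyRealizable (2 * p + 1) (oddGapPoly p k) →
      ∃ A : Matrix (Fin (2 * p + 1)) (Fin (2 * p + 1)) ℝ,
        A.IsIrreducible ∧ IsSimpleEBL A ∧ A.charpoly = oddGapPoly p k) :=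
  theorem28_general p (by omega) k hP
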